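/- Let $n\ge 1$. For $V\in L^1_{loc}(\mathbb R^n;\mathbb C)$ let $|V|-\Delta$ denote the non-negative self-adjoint operator on $L^2(\mathbb R^n)$ associated with the form $(u,v)\mapsto\int\nabla u\cdot\overline{\nabla v}\,dx+\int|V|\,u\,\overline v\,dx$ on $H^{1,V}(\mathbb R^n)=\{u\in H^1(\mathbb R^n): |V|^{1/2}u\in L^2(\mathbb R^n)\}$. For $\alpha\in[1,2]$ set $$[V]_\alpha:=\sup_{u\in D(|V|-\Delta),\,u\neq0}\frac{\big\||V|^{\alpha/2}u\big\|_2+\big\|(-\Delta)^{\alpha/2}u\big\|_2}{\big\|(|V|-\Delta)^{\alpha/2}u\big\|_2}\in[0,\infty],$$ where a norm in the numerator is $\infty$ if $u$ is not in the domain of the operator in question, and let $\mathcal W_\alpha$ be the class of all $V\in L^1_{loc}(\mathbb R^n;\mathbb C)$ with $[V]_\alpha<\infty$. If $V\in\mathcal W_\alpha$ for some $\alpha\in(1,2]$, then $V\in\mathcal W_\beta$ for every $\beta\in[1,\alpha]$, and $$[V]_\beta\le 2\,[V]_\alpha^{\frac{\beta-1}{\alpha-1}}.$$ Therefore $\mathcal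 W_\alpha\subseteq\mathcal W_\beta$ whenever $1\le\beta\le\alpha\le2$. -/

import Mathlib

open MeasureTheory Set
open scoped ENNReal SchwartzMap LineDeriv FourierTransform InnerProductSpace ComplexConjugate

noncomputable section

namespace KatoPotential

/-- Euclidean space `ℝⁿ`. -/
abbrev Rn (n : ℕ) : Type := EuclideanSpace ℝ (Fin n)

/-- The complex Hilbert space `L²(ℝⁿ)` with respect to Lebesgue measure. -/
abbrev L2 (n : ℕ) : Type := Lp (α := Rn n) ℂ 2 (volume : Measure (Rn n))

variable {n : ℕ}

/-! ### Weak derivatives and the form domain -/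

/-- The pairs `(u, g)` of `L²` functions such that `g` is the weak partial derivative `∂ᵢ u`
(in the sense of distributions). -/
def weakDerivGraph (n : ℕ) (i : Fin n) : Submodule ℂ (L2 n × L2 n) where
  carrier := {p | ∂_{EuclideanSpace.single i (1 : ℝ)} (p.1 : 𝓢'(Rn n, ℂ)) = (p.2 : 𝓢'(Rn n, ℂ))}
  add_mem' := by
    intro p q hp hq
    simp only [mem_ofPred_eq, ← Lp.toTemperedDistributionCLM_apply, Prod.fst_add, Prod.snd_add,
      map_add, LineDeriv.lineDerivOp_add] at hp hq ⊢
    rw [hp, hq]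
  zero_mem' := by
    simp [← Lp.toTemperedDistributionCLM_apply]
  smul_mem' := by
    intro c p hp
    simp only [mem_ofPred_eq, ← Lp.toTemperedDistributionCLM_apply, Prod.smul_fst, Prod.smul_snd,
      map_smul, LineDeriv.lineDerivOp_smul] at hp ⊢
    rw [hp]

/-- The weak partial derivative `∂ᵢ`, an unbounded operator on `L²(ℝⁿ)` whose domain is the set
of all `u ∈ L²` with `∂ᵢ u ∈ L²`. -/
def weakDeriv (n : ℕ) (i : Fin n) : L2 n →ₗ.[ℂ] L2 n := (weakDerivGraph n i).toLinearPMap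

/-- The Sobolev space `H¹(ℝⁿ)`. -/
def H1 (n : ℕ) : Submodule ℂ (L2 n) := ⨅ i : Fin n, (weakDeriv n i).domain

/-- The domain in `L²(ℝⁿ)` of the multiplication operator by `|V|^{1/2}`. -/
def sqrtDomain (V : Rn n → ℂ) : Submodule ℂ (L2 n) where
  carrier := {u | MemLp (fun x => ((‖V x‖ ^ (1 / 2 : ℝ) : ℝ) : ℂ) * u x) 2 volume}
  add_mem' := by
    intro u v hu hv
    refine (hu.add hv).ae_eq ?_
    filter_upwards [Lp.coeFn_add u v] with x hx
    simp only [hx, Pi.add_apply, mul_add]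
  zero_mem' := by
    refine (MemLp.zero (ε := ℂ)).ae_eq ?_
    filter_upwards [Lp.coeFn_zero ℂ 2 (volume : Measure (Rn n))] with x hx
    simp
  smul_mem' := by
    intro c u hu
    refine (hu.const_smul c).ae_eq ?_
    filter_upwards [Lp.coeFn_smul c u] with x hx
    simp only [hx, Pi.smul_apply, smul_eq_mul]
    ring

/-- The form domain `H^{1,V}(ℝⁿ) = {u ∈ H¹(ℝⁿ) : |V|^{1/2} u ∈ L²(ℝⁿ)}`. -/
def H1V (V : Rn n → ℂ) : Submodule ℂ (L2 n) := H1 n ⊓ sqrtDomain V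

/-- `∂ᵢ u` for `u` in the form domain. -/
def partialD (V : Rn n → ℂ) (i : Fin n) : H1V V →ₗ[ℂ] L2 n :=
  (weakDeriv n i).toFun ∘ₗ
    Submodule.inclusion (inf_le_left.trans (iInf_le (fun i => (weakDeriv n i).domain) i))

/-- The form `(u, v) ↦ ∫ ∇u · conj ∇v + ∫ |V| u conj v` on `H^{1,V}(ℝⁿ)`; recall that the inner
product of Mathlib is conjugate-linear in its first argument. -/
def form (V : Rn n → ℂ) (u v : H1V V) : ℂ :=
  (∑ i : Fin n, ⟪partialD V i v, partialD V i u⟫_ℂ) +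
    ∫ x, (‖V x‖ : ℂ) * (u : L2 n) x * conj ((v : L2 n) x)

/-! ### The Schrödinger operator with potential `|V|` -/

lemma integrable_form (V : Rn n → ℂ) (u v : H1V V) :
    Integrable (fun x => (‖V x‖ : ℂ) * (u : L2 n) x * conj ((v : L2 n) x)) volume := by
  have hu : MemLp (fun x => ((‖V x‖ ^ (1 / 2 : ℝ) : ℝ) : ℂ) * (u : L2 n) x) 2 volume := u.2.2
  have hv : MemLp (fun x => ((‖V x‖ ^ (1 / 2 : ℝ) : ℝ) : ℂ) * (v : L2 n) x) 2 volume := v.2.2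
  refine (hu.integrable_mul hv.star).congr (Filter.Eventually.of_forall fun x => ?_)
  have h : (‖V x‖ ^ (1 / 2 : ℝ)) * (‖V x‖ ^ (1 / 2 : ℝ)) = ‖V x‖ := by
    rw [← Real.sqrt_eq_rpow, Real.mul_self_sqrt (norm_nonneg _)]
  have h' : ((‖V x‖ ^ (1 / 2 : ℝ) : ℝ) : ℂ) * ((‖V x‖ ^ (1 / 2 : ℝ) : ℝ) : ℂ) = (‖V x‖ : ℂ) := by
    exact_mod_cast h
  simp only [Pi.mul_apply, Pi.star_apply, star_mul', RCLike.star_def, Complex.conj_ofReal]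
  rw [← h']
  ring

lemma form_add (V : Rn n → ℂ) (u u' v : H1V V) :
    form V (u + u') v = form V u v + form V u' v := by
  have h : ∫ x, (‖V x‖ : ℂ) * ((u + u' : H1V V) : L2 n) x * conj ((v : L2 n) x) =
      (∫ x, (‖V x‖ : ℂ) * (u : L2 n) x * conj ((v : L2 n) x)) +
      ∫ x, (‖V x‖ : ℂ) * (u' : L2 n) x * conj ((v : L2 n) x) := by
    rw [← integral_add (integrable_form V u v) (integrable_form V u' v)]
    refine integral_congr_ae ?_
    filter_upwards [Lp.coeFn_add (u : L2 n) (u' : L2 n)] with x hx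
    simp only [Submodule.coe_add, hx, Pi.add_apply]
    ring
  simp only [form, h, map_add, inner_add_right, Finset.sum_add_distrib]
  ring

lemma form_smul (V : Rn n → ℂ) (c : ℂ) (u v : H1V V) :
    form V (c • u) v = c * form V u v := by
  have h : ∫ x, (‖V x‖ : ℂ) * ((c • u : H1V V) : L2 n) x * conj ((v : L2 n) x) =
      c * ∫ x, (‖V x‖ : ℂ) * (u : L2 n) x * conj ((v : L2 n) x) := by
    rw [← integral_const_mul]
    refine integral_congr_ae ?_
    filter_upwards [Lp.coeFn_smul c (u : L2 n)] with x hx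
    simp only [Submodule.coe_smul, hx, Pi.smul_apply, smul_eq_mul]
    ring
  simp only [form, h, map_smul, inner_smul_right, ← Finset.mul_sum]
  ring

/-- The graph of `|V| - Δ`: all pairs `(u, w)` with `u ∈ H^{1,V}`, `w ∈ L²` and
`form V u v = ⟨w, v⟩` for every `v ∈ H^{1,V}`. -/
def schrodingerGraph (V : Rn n → ℂ) : Submodule ℂ (L2 n × L2 n) where
  carrier := {p | ∃ h : p.1 ∈ H1V V, ∀ v : H1V V, form V ⟨p.1, h⟩ v = ⟪(v : L2 n), p.2⟫_ℂ}
  add_mem' := by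
    rintro p q ⟨hp, hp'⟩ ⟨hq, hq'⟩
    refine ⟨(H1V V).add_mem hp hq, fun v => ?_⟩
    rw [Prod.snd_add, inner_add_right, ← hp' v, ← hq' v, ← form_add]
    rfl
  zero_mem' := by
    refine ⟨(H1V V).zero_mem, fun v => ?_⟩
    have := form_smul V 0 0 v
    rw [zero_smul, zero_mul] at this
    rw [Prod.snd_zero, inner_zero_right, ← this]
    rfl
  smul_mem' := by
    rintro c p ⟨hp, hp'⟩
    refine ⟨(H1V V).smul_mem c hp, fun v => ?_⟩
    rw [Prod.smul_snd, inner_smul_right, ← hp' v, ← form_smul]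
    rfl

/-- The non-negative self-adjoint operator `|V| - Δ` on `L²(ℝⁿ)` associated with the form. -/
def schrodinger (V : Rn n → ℂ) : L2 n →ₗ.[ℂ] L2 n := (schrodingerGraph V).toLinearPMap

/-! ### Fractional powers of non-negative self-adjoint operators -/

section FractionalPower

variable {H : Type*} [NormedAddCommGroup H] [InnerProductSpace ℂ H] [CompleteSpace H]

/-- The bounded operator `R` is `(1 + A)⁻¹`, that is, `R f ∈ D(A)` and `A (R f) = f - R f` for
every `f`. For a non-negative symmetric operator `A` there is at most one such `R`. -/
def IsResolvent (A : H →ₗ.[ℂ] H) (R : H →L[ℂ] H) : Prop := ∀ f : H, (R f, f - R f) ∈ A.graph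

/-- The resolvent `R = (1 + A)⁻¹` of a non-negative self-adjoint operator `A`. -/
def resolvent (A : H →ₗ.[ℂ] H) : H →L[ℂ] H := Classical.epsilon (IsResolvent A)

/-- The fractional power `A ^ γ`, `γ ≥ 0`, of a non-negative self-adjoint operator `A`. With
`R = (1 + A)⁻¹`, so that `1 - R = A (1 + A)⁻¹` and `0 ≤ R ≤ 1`, it is the closed operator
`(R ^ γ)⁻¹ (1 - R) ^ γ` of the functional calculus of `A`: one has `u ∈ D(A ^ γ)` and
`A ^ γ u = w` if and only if `(1 - R) ^ γ u = R ^ γ w`. Here the powers of the bounded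
non-negative operators `R` and `1 - R` are those of the continuous functional calculus. -/
def fracPow (A : H →ₗ.[ℂ] H) (γ : ℝ) : H →ₗ.[ℂ] H :=
  Submodule.toLinearPMap <| LinearMap.ker
    ((CFC.rpow (1 - resolvent A) γ).toLinearMap ∘ₗ LinearMap.fst ℂ H H -
      (CFC.rpow (resolvent A) γ).toLinearMap ∘ₗ LinearMap.snd ℂ H H)

end FractionalPower

/-! ### The potential classes -/

/-- The norm `‖|V|^s u‖₂`, equal to `∞` if `|V|^s u ∉ L²(ℝⁿ)`. -/
def potNorm (V : Rn n → ℂ) (s : ℝ) (u : L2 n) : ℝ≥0∞ :=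
  eLpNorm (fun x => ((‖V x‖ ^ s : ℝ) : ℂ) * u x) 2 volume

/-- The norm `‖(-Δ)^s u‖₂`, where `(-Δ)^s` is the Fourier multiplier with symbol `(2π|ξ|)^{2s}`;
it is equal to `∞` if `u` is not in the domain of `(-Δ)^s`. -/
def lapNorm (s : ℝ) (u : L2 n) : ℝ≥0∞ :=
  eLpNorm (fun ξ => (((2 * Real.pi * ‖ξ‖) ^ (2 * s) : ℝ) : ℂ) * (𝓕 u : L2 n) ξ) 2 volume

/-- The quantity `[V]_α`: the supremum over `u ∈ D(|V| - Δ)` of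
`(‖|V|^{α/2} u‖₂ + ‖(-Δ)^{α/2} u‖₂) / ‖(|V| - Δ)^{α/2} u‖₂`, where `0 / 0 = 0`. -/
def bracket (V : Rn n → ℂ) (α : ℝ) : ℝ≥0∞ :=
  ⨆ (u : (fracPow (schrodinger V) (α / 2)).domain) (_ : (u : L2 n) ∈ (schrodinger V).domain),
    (potNorm V (α / 2) u + lapNorm (α / 2) (u : L2 n)) / ‖fracPow (schrodinger V) (α / 2) u‖ₑ

/-- The class `𝒲_α` of potentials on `ℝⁿ`. -/
def W (n : ℕ) (α : ℝ) : Set (Rn n → ℂ) :=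
  {V | LocallyIntegrable V volume ∧ bracket V α < ∞}

end KatoPotential

end

/-! Write A = |V| - Δ, R = (1 + A)⁻¹ and u = R f; such u exhaust D(A). The form gives ‖A^{1/2}u‖² =
‖∇u‖² + ‖|V|^{1/2}u‖², so at exponent 1/2 both |V|^{1/2} and (-Δ)^{1/2} are dominated by A^{1/2}
with constant 1 (`half_power_bounds`). At exponent α/2 each is dominated with constant [V]_α.
Interpolation at θ = (β-1)/(α-1) gives the constant [V]_α^θ at exponent β/2 for each of them, and
the factor 2 comes from adding the two.

The interpolation (`eLpNorm_rpow_mul_le_interpolate`) is of Heinz type and uses no complex analysis.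
Up to a Fourier transform T, both operators are multiplications by some m ≥ 0. With m truncated at k
and A replaced by ε + A, everything is bounded, and N(s) = ‖min(m,k)^s T (ε + A)^{-s}‖ satisfies
N((s+t)/2)² ≤ N(s) N(t) (`norm_comp_sq_le`), because the norm of a self-adjoint product is its
spectral radius, which is invariant under cyclic permutation. A bounded function with this property
lies below its log-linear interpolant (`norm_comp_le_interpolate`). The bounds do not depend on ε
and k, so ε → 0 and k → ∞.

Powers of A enter only through the continuous functional calculus of R. The construction of R from
the form is `exists_isResolvent_schrodinger`. -/

noncomputable section

namespace KatoPotential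

/-! ### Abstract interpolation by midpoint log-convexity of operator norms. -/

section Interpolation

variable {H K : Type*} [NormedAddCommGroup H] [InnerProductSpace ℂ H] [CompleteSpace H]
  [NormedAddCommGroup K] [InnerProductSpace ℂ K] [CompleteSpace K]

open ContinuousLinearMap in
/-- The norm of a self-adjoint product is bounded by the norm of the product in reverse order. -/
lemma norm_mul_le_norm_mul_comm (a b : H →L[ℂ] H) (h : IsSelfAdjoint (a * b)) :
    ‖a * b‖ ≤ ‖b * a‖ := by
  rcases subsingleton_or_nontrivial H with hH | hH
  · have : a * b = 0 := by ext x; exact Subsingleton.elim _ _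
    simp [this]
  -- The spectra of `a * b` and `b * a` agree away from 0, and the norm of a self-adjoint operator
  -- is its spectral radius.
  have h1 : spectralRadius ℂ (a * b) ≤ spectralRadius ℂ (b * a) := by
    refine iSup₂_le fun z hz => ?_
    by_cases h0 : z = 0
    · simp [h0]
    · have : z ∈ spectrum ℂ (b * a) \ {0} := by
        rw [← spectrum.nonzero_mul_comm]; exact ⟨hz, h0⟩
      exact le_iSup₂ (f := fun z (_ : z ∈ spectrum ℂ (b * a)) => (‖z‖₊ : ℝ≥0∞)) z this.1
  have h2 := (h.spectralRadius_eq_nnnorm ▸ h1).trans (spectrum.spectralRadius_le_nnnorm _)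
  exact_mod_cast h2

-- Here G₀, G, G₁ are equally spaced powers of one operator and D is the common step. The square
-- (SG)*(SG) has D as its leftmost factor; moving D cyclically to the right end turns it into
-- (S₀G₀)*(S₁G₁), and the norm can only grow.
open ContinuousLinearMap in
lemma norm_comp_sq_le {S₀ S S₁ : H →L[ℂ] K} {G₀ G G₁ D : H →L[ℂ] H}
    (hS : adjoint S ∘L S = adjoint S₀ ∘L S₁)
    (hG₀ : IsSelfAdjoint G₀) (hG : IsSelfAdjoint G) (h₀ : G = D * G₀) (h₁ : G₁ = G * D) :
    ‖S ∘L G‖ ^ 2 ≤ ‖S₀ ∘L G₀‖ * ‖S₁ ∘L G₁‖ := by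
  have e1 : adjoint (S ∘L G) ∘L (S ∘L G) = D * (G₀ * (adjoint S₀ ∘L S₁) * G) := by
    rw [← hS, adjoint_comp, ← star_eq_adjoint G, hG.star_eq]
    conv_lhs => enter [1]; rw [h₀]
    rfl
  have e2 : (G₀ * (adjoint S₀ ∘L S₁) * G) * D = adjoint (S₀ ∘L G₀) ∘L (S₁ ∘L G₁) := by
    rw [h₁, adjoint_comp, ← star_eq_adjoint G₀, hG₀.star_eq]
    rfl
  have e3 : IsSelfAdjoint (D * (G₀ * (adjoint S₀ ∘L S₁) * G)) := by
    rw [← e1]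
    exact (isPositive_adjoint_comp_self _).isSelfAdjoint
  calc ‖S ∘L G‖ ^ 2 = ‖adjoint (S ∘L G) ∘L (S ∘L G)‖ := by
        rw [norm_adjoint_comp_self, sq]
    _ ≤ ‖adjoint (S₀ ∘L G₀) ∘L (S₁ ∘L G₁)‖ := by
        rw [e1, ← e2]; exact norm_mul_le_norm_mul_comm _ _ e3
    _ ≤ _ := (opNorm_comp_le _ _).trans (by rw [LinearIsometryEquiv.norm_map])

/-- A bounded function on `[0, 1]` that is logarithmically midpoint convex with respect to the
endpoints and at most `1` at the endpoints is at most `1`. -/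
lemma le_one_of_sq_le_mul {φ : ℝ → ℝ} {C : ℝ} (hC : ∀ t ∈ Icc (0 : ℝ) 1, φ t ≤ C)
    (hpos : ∀ t ∈ Icc (0 : ℝ) 1, 0 ≤ φ t) (h0 : φ 0 ≤ 1) (h1 : φ 1 ≤ 1)
    (hmid : ∀ s ∈ Icc (0 : ℝ) 1, ∀ t ∈ Icc (0 : ℝ) 1, s ≤ t → φ ((s + t) / 2) ^ 2 ≤ φ s * φ t) :
    ∀ t ∈ Icc (0 : ℝ) 1, φ t ≤ 1 := by
  have hbdd : BddAbove (φ '' Icc 0 1) := ⟨C, by rintro _ ⟨t, ht, rfl⟩; exact hC t ht⟩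
  set M := sSup (φ '' Icc 0 1) with hM
  have hle : ∀ t ∈ Icc (0 : ℝ) 1, φ t ≤ M := fun t ht => le_csSup hbdd ⟨t, ht, rfl⟩
  have hM0 : 0 ≤ M := (hpos 0 (by simp)).trans (hle 0 (by simp))
  -- Each t is the midpoint of an endpoint of [0, 1], where φ ≤ 1, and another point of [0, 1],
  -- where φ ≤ M.
  have key : ∀ t ∈ Icc (0 : ℝ) 1, φ t ^ 2 ≤ M := by
    intro t ht
    rcases le_total t (1 / 2) with h | h
    · have ht2 : 2 * t ∈ Icc (0 : ℝ) 1 := ⟨by linarith [ht.1], by linarith⟩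
      have := hmid 0 (by simp) (2 * t) ht2 ht2.1
      rw [show (0 + 2 * t) / 2 = t by ring] at this
      nlinarith [hle _ ht2, hpos _ ht2, hpos 0 (by simp)]
    · have ht2 : 2 * t - 1 ∈ Icc (0 : ℝ) 1 := ⟨by linarith, by linarith [ht.2]⟩
      have := hmid (2 * t - 1) ht2 1 (by simp) ht2.2
      rw [show (2 * t - 1 + 1) / 2 = t by ring] at this
      nlinarith [hle _ ht2, hpos _ ht2, hpos 1 (by simp)]
  have hsup : M ≤ Real.sqrt M := by
    refine csSup_le ⟨_, 0, by simp, rfl⟩ ?_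
    rintro _ ⟨t, ht, rfl⟩
    exact Real.le_sqrt_of_sq_le (key t ht)
  have hM1 : M ≤ 1 := by
    by_contra! h
    have h2 : M * M ≤ M := by
      calc M * M ≤ Real.sqrt M * Real.sqrt M := by gcongr
        _ = M := Real.mul_self_sqrt hM0
    nlinarith
  exact fun t ht => (hle t ht).trans hM1

open ContinuousLinearMap in
/-- Interpolation of the bounds on `S s ∘ G s` between `s = a` and `s = b`, where `S` and `G`
behave as the powers of non-negative operators. -/
lemma norm_comp_le_interpolate {S : ℝ → H →L[ℂ] K} {G : ℝ → H →L[ℂ] H} {a b M₀ M₁ C : ℝ}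
    (ha : 0 ≤ a) (hab : a ≤ b) (hM₀ : 0 < M₀) (hM₁ : 0 < M₁)
    (hS : ∀ r ∈ Icc a b, ∀ s ∈ Icc a b, ∀ t ∈ Icc a b, s + t = 2 * r →
      adjoint (S r) ∘L S r = adjoint (S s) ∘L S t)
    (hG : ∀ s, 0 ≤ s → IsSelfAdjoint (G s))
    (hGadd : ∀ s t, 0 ≤ s → 0 ≤ t → G (s + t) = G s * G t)
    (hC : ∀ s ∈ Icc a b, ‖S s ∘L G s‖ ≤ C)
    (h₀ : ‖S a ∘L G a‖ ≤ M₀) (h₁ : ‖S b ∘L G b‖ ≤ M₁) {θ : ℝ} (hθ : θ ∈ Icc (0 : ℝ) 1) :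
    ‖S ((1 - θ) * a + θ * b) ∘L G ((1 - θ) * a + θ * b)‖ ≤ M₀ ^ (1 - θ) * M₁ ^ θ := by
  set γ : ℝ → ℝ := fun t => (1 - t) * a + t * b with hγ
  have hγmem : ∀ t ∈ Icc (0 : ℝ) 1, γ t ∈ Icc a b := fun t ht => by
    constructor <;> simp only [hγ] <;> nlinarith [ht.1, ht.2]
  have hpos : ∀ t : ℝ, 0 < M₀ ^ (1 - t) * M₁ ^ t := fun t => by positivity
  have hcont : Continuous fun t : ℝ => M₀ ^ (1 - t) * M₁ ^ t := by
    refine Continuous.mul ?_ ?_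
    · exact continuous_const.rpow (by fun_prop) fun t => Or.inl hM₀.ne'
    · exact continuous_const.rpow (by fun_prop) fun t => Or.inl hM₁.ne'
  -- The minimum of the interpolant is positive, so the normalized function stays bounded; the size
  -- of that bound plays no role in the conclusion.
  obtain ⟨t₀, -, ht₀⟩ := isCompact_Icc.exists_isMinOn (s := Icc (0 : ℝ) 1) ⟨0, by simp⟩
    hcont.continuousOn
  have hC0 : 0 ≤ C := (norm_nonneg _).trans (hC a ⟨le_rfl, hab⟩)
  have main := le_one_of_sq_le_mul
    (φ := fun t => ‖S (γ t) ∘L G (γ t)‖ / (M₀ ^ (1 - t) * M₁ ^ t))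
    (C := C / (M₀ ^ (1 - t₀) * M₁ ^ t₀)) ?_ ?_ ?_ ?_ ?_ θ hθ
  · exact (div_le_one (hpos θ)).1 main
  · intro t ht
    exact div_le_div₀ hC0 (hC _ (hγmem t ht)) (hpos _) (ht₀ ht)
  · intro t _
    have := hpos t
    positivity
  · simpa [hγ] using div_le_one_of_le₀ h₀ hM₀.le
  · simpa [hγ] using div_le_one_of_le₀ h₁ hM₁.le
  · intro s hs t ht hst
    have hs' := hγmem s hs
    have ht' := hγmem t ht
    have hm : (s + t) / 2 ∈ Icc (0 : ℝ) 1 := ⟨by linarith [hs.1, ht.1], by linarith [hs.2, ht.2]⟩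
    have hm' := hγmem _ hm
    have hd : 0 ≤ (γ t - γ s) / 2 := by simp only [hγ]; nlinarith
    have e1 : γ ((s + t) / 2) = (γ t - γ s) / 2 + γ s := by simp only [hγ]; ring
    have e2 : γ t = γ ((s + t) / 2) + (γ t - γ s) / 2 := by simp only [hγ]; ring
    have := norm_comp_sq_le (G₀ := G (γ s)) (G := G (γ ((s + t) / 2))) (G₁ := G (γ t))
      (D := G ((γ t - γ s) / 2))
      (hS _ hm' _ hs' _ ht' (by simp only [hγ]; ring)) (hG _ (ha.trans hs'.1))
      (hG _ (ha.trans hm'.1))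
      (by rw [← hGadd _ _ hd (ha.trans hs'.1), ← e1])
      (by rw [← hGadd _ _ (ha.trans hm'.1) hd, ← e2])
    rw [div_pow, div_mul_div_comm]
    -- The normalizing factor is log-affine, so dividing by it preserves the midpoint inequality.
    have e3 : (M₀ ^ (1 - s) * M₁ ^ s) * (M₀ ^ (1 - t) * M₁ ^ t)
        = (M₀ ^ (1 - (s + t) / 2) * M₁ ^ ((s + t) / 2)) ^ 2 := by
      have f1 : M₀ ^ (1 - s) * M₀ ^ (1 - t) =
          M₀ ^ (1 - (s + t) / 2) * M₀ ^ (1 - (s + t) / 2) := by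
        rw [← Real.rpow_add hM₀, ← Real.rpow_add hM₀]; ring_nf
      have f2 : M₁ ^ s * M₁ ^ t = M₁ ^ ((s + t) / 2) * M₁ ^ ((s + t) / 2) := by
        rw [← Real.rpow_add hM₁, ← Real.rpow_add hM₁]; ring_nf
      calc _ = (M₀ ^ (1 - s) * M₀ ^ (1 - t)) * (M₁ ^ s * M₁ ^ t) := by ring
        _ = _ := by rw [f1, f2]; ring
    rw [e3]
    gcongr

end Interpolation

/-! ### Norm comparison in the continuous functional calculus. -/

section FunctionalCalculus

variable {H : Type*} [NormedAddCommGroup H] [InnerProductSpace ℂ H] [CompleteSpace H]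

lemma spectrum_subset_Icc {R : H →L[ℂ] H} (h0 : 0 ≤ R) (h1 : R ≤ 1) :
    spectrum ℝ R ⊆ Icc 0 1 := fun x hx =>
  ⟨spectrum_nonneg_of_nonneg h0 hx,
    (le_algebraMap_iff_spectrum_le (R := ℝ) (A := H →L[ℂ] H) (a := R) (r := 1)
      (h0.isSelfAdjoint)).1 (by simpa using h1) x hx⟩

lemma inner_cfc_apply (f : ℝ → ℝ) (R : H →L[ℂ] H) (u v : H) :
    ⟪cfc f R u, v⟫_ℂ = ⟪u, cfc f R v⟫_ℂ := by
  have h : IsSelfAdjoint (cfc f R) := cfc_predicate f R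
  rw [← ContinuousLinearMap.adjoint_inner_right, ← ContinuousLinearMap.star_eq_adjoint, h.star_eq]

lemma norm_cfc_apply_sq {f : ℝ → ℝ} {R : H →L[ℂ] H} (hf : ContinuousOn f (spectrum ℝ R))
    (u : H) : ‖cfc f R u‖ ^ 2 = RCLike.re ⟪u, cfc (fun x => f x * f x) R u⟫_ℂ := by
  rw [cfc_mul f f R hf hf, mul_apply_eq_comp, ← inner_cfc_apply,
    ← inner_self_eq_norm_sq (𝕜 := ℂ)]

/-- Monotonicity of the functional calculus applied to f² ≤ g², evaluated as a quadratic form at u.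
-/
lemma norm_cfc_apply_le {f g : ℝ → ℝ} {R : H →L[ℂ] H} (hf : ContinuousOn f (spectrum ℝ R))
    (hg : ContinuousOn g (spectrum ℝ R)) (h0 : ∀ x ∈ spectrum ℝ R, 0 ≤ f x)
    (h : ∀ x ∈ spectrum ℝ R, f x ≤ g x) (u : H) : ‖cfc f R u‖ ≤ ‖cfc g R u‖ := by
  have h1 : cfc (fun x => f x * f x) R ≤ cfc (fun x => g x * g x) R :=
    cfc_mono (fun x hx => mul_self_le_mul_self (h0 x hx) (h x hx)) (hf.mul hf) (hg.mul hg)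
  have h2 := (ContinuousLinearMap.le_def _ _).1 h1
  have h3 := h2.re_inner_nonneg_right u
  rw [sub_apply, inner_sub_right, map_sub, ← norm_cfc_apply_sq hf,
    ← norm_cfc_apply_sq hg] at h3
  exact le_of_sq_le_sq (by linarith) (norm_nonneg _)

end FunctionalCalculus

/-! ### Passage between the powers of A and those of ε + A. -/

section Regularization

variable {H K : Type*} [NormedAddCommGroup H] [InnerProductSpace ℂ H] [CompleteSpace H]
  [NormedAddCommGroup K] [InnerProductSpace ℂ K]

/-- If `R = (1 + A)⁻¹`, then `powRes R s f = A ^ s (R f)`. -/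
def powRes (R : H →L[ℂ] H) (s : ℝ) : H →L[ℂ] H :=
  cfc (fun x : ℝ => x ^ (1 - s) * (1 - x) ^ s) R

/-- If `R = (1 + A)⁻¹`, then `regPow R ε s = (ε + A) ^ (-s)`. -/
def regPow (R : H →L[ℂ] H) (ε s : ℝ) : H →L[ℂ] H :=
  cfc (fun x : ℝ => (x / (1 - (1 - ε) * x)) ^ s) R

/-- If `R = (1 + A)⁻¹`, then `regPowRes R ε s f = (ε + A) ^ s (R f)`. -/
def regPowRes (R : H →L[ℂ] H) (ε s : ℝ) : H →L[ℂ] H :=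
  cfc (fun x : ℝ => x ^ (1 - s) * (1 - (1 - ε) * x) ^ s) R

variable {R : H →L[ℂ] H} {ε s t : ℝ}

lemma continuousOn_powRes_symbol {S : Set ℝ} (hs : s ∈ Icc (0 : ℝ) 1) :
    ContinuousOn (fun x : ℝ => x ^ (1 - s) * (1 - x) ^ s) S :=
  ContinuousOn.mul (continuousOn_id.rpow_const fun _ _ => Or.inr (by linarith [hs.2]))
    (ContinuousOn.rpow_const (by fun_prop) fun _ _ => Or.inr hs.1)

lemma continuousOn_regPowRes_symbol {S : Set ℝ} (hs : s ∈ Icc (0 : ℝ) 1) :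
    ContinuousOn (fun x : ℝ => x ^ (1 - s) * (1 - (1 - ε) * x) ^ s) S :=
  ContinuousOn.mul (continuousOn_id.rpow_const fun _ _ => Or.inr (by linarith [hs.2]))
    (ContinuousOn.rpow_const (by fun_prop) fun _ _ => Or.inr hs.1)

/-- At x = 1/(1 + λ) this quantity is (ε + λ)x; it is at least ε on [0, 1], which keeps the symbol
of (ε + A)^{-s} continuous up to x = 1. -/
lemma regularization_denom_pos (hε : ε ∈ Ioo (0 : ℝ) 1) {x : ℝ} (hx : x ∈ Icc (0 : ℝ) 1) :
    0 < 1 - (1 - ε) * x := by nlinarith [hε.1, hε.2, hx.1, hx.2]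

lemma continuousOn_regPow_symbol (hε : ε ∈ Ioo (0 : ℝ) 1) (hs : 0 ≤ s) :
    ContinuousOn (fun x : ℝ => (x / (1 - (1 - ε) * x)) ^ s) (Icc 0 1) :=
  ContinuousOn.rpow_const (ContinuousOn.div continuousOn_id (by fun_prop)
    fun x hx => (regularization_denom_pos hε hx).ne') fun _ _ => Or.inr hs

lemma isSelfAdjoint_regPow : IsSelfAdjoint (regPow R ε s) := cfc_predicate _ R

lemma regPow_add (h0 : 0 ≤ R) (h1 : R ≤ 1) (hε : ε ∈ Ioo (0 : ℝ) 1) (hs : 0 ≤ s) (ht : 0 ≤ t) :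
    regPow R ε (s + t) = regPow R ε s * regPow R ε t := by
  have hsub := spectrum_subset_Icc h0 h1
  rw [regPow, regPow, regPow, ← cfc_mul _ _ R ((continuousOn_regPow_symbol hε hs).mono hsub)
    ((continuousOn_regPow_symbol hε ht).mono hsub)]
  refine cfc_congr fun x hx => ?_
  exact Real.rpow_add_of_nonneg
    (div_nonneg (hsub hx).1 (regularization_denom_pos hε (hsub hx)).le) hs ht

lemma regPow_mul_regPowRes (h0 : 0 ≤ R) (h1 : R ≤ 1) (hε : ε ∈ Ioo (0 : ℝ) 1)
    (hs : s ∈ Icc (0 : ℝ) 1) : regPow R ε s * regPowRes R ε s = R := by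
  have hsub := spectrum_subset_Icc h0 h1
  rw [regPow, regPowRes, ← cfc_mul _ _ R ((continuousOn_regPow_symbol hε hs.1).mono hsub)
    (continuousOn_regPowRes_symbol hs)]
  conv_rhs => rw [← cfc_id' ℝ R h0.isSelfAdjoint]
  refine cfc_congr fun x hx => ?_
  have hD := regularization_denom_pos hε (hsub hx)
  have hx0 := (hsub hx).1
  rw [Real.div_rpow hx0 hD.le]
  have e : x ^ s * x ^ (1 - s) = x := by
    rw [← Real.rpow_add_of_nonneg hx0 hs.1 (by linarith [hs.2])]; simp
  have : (1 - (1 - ε) * x) ^ s ≠ 0 := (Real.rpow_pos_of_pos hD s).ne'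
  field_simp
  exact e

lemma norm_regPow_le (h0 : 0 ≤ R) (h1 : R ≤ 1) (hε : ε ∈ Ioo (0 : ℝ) 1)
    (hs : s ∈ Icc (0 : ℝ) 1) : ‖regPow R ε s‖ ≤ ε⁻¹ := by
  have hsub := spectrum_subset_Icc h0 h1
  have hε1 : 1 ≤ ε⁻¹ := one_le_inv_iff₀.2 ⟨hε.1, hε.2.le⟩
  refine norm_cfc_le (by positivity) fun x hx => ?_
  have hD := regularization_denom_pos hε (hsub hx)
  have hq : 0 ≤ x / (1 - (1 - ε) * x) := div_nonneg (hsub hx).1 hD.le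
  rw [Real.norm_of_nonneg (Real.rpow_nonneg hq _)]
  -- The maximum is attained at x = 1, that is, at λ = 0.
  have hle : x / (1 - (1 - ε) * x) ≤ ε⁻¹ := by
    rw [div_le_iff₀ hD, inv_mul_eq_div, le_div_iff₀ hε.1]
    nlinarith [(hsub hx).2]
  calc _ ≤ (ε⁻¹) ^ s := Real.rpow_le_rpow hq hle hs.1
    _ ≤ (ε⁻¹) ^ (1 : ℝ) := Real.rpow_le_rpow_of_exponent_le hε1 hs.2
    _ = ε⁻¹ := Real.rpow_one _

lemma norm_powRes_apply_le (h0 : 0 ≤ R) (h1 : R ≤ 1) (hε : ε ∈ Ioo (0 : ℝ) 1)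
    (hs : s ∈ Icc (0 : ℝ) 1) (f : H) : ‖powRes R s f‖ ≤ ‖regPowRes R ε s f‖ := by
  have hsub := spectrum_subset_Icc h0 h1
  refine norm_cfc_apply_le (continuousOn_powRes_symbol hs) (continuousOn_regPowRes_symbol hs)
    (fun x hx => ?_) (fun x hx => ?_) f
  · have := (hsub hx).1
    have := (hsub hx).2
    have : 0 ≤ 1 - x := by linarith
    positivity
  · have hx0 := (hsub hx).1
    have hx1 := (hsub hx).2
    have : 1 - x ≤ 1 - (1 - ε) * x := by nlinarith [hε.1]
    exact mul_le_mul_of_nonneg_left (Real.rpow_le_rpow (by linarith) this hs.1)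
      (Real.rpow_nonneg hx0 _)

/-- A self-adjoint operator has dense range once it is injective, and the kernel here lies in the
kernel of R because R factors through it. -/
lemma denseRange_regPowRes (h0 : 0 ≤ R) (h1 : R ≤ 1) (hR : Function.Injective R)
    (hε : ε ∈ Ioo (0 : ℝ) 1) (hs : s ∈ Icc (0 : ℝ) 1) : DenseRange (regPowRes R ε s) := by
  have hsa : IsSelfAdjoint (regPowRes R ε s) := cfc_predicate _ R
  have hker : (regPowRes R ε s).range.topologicalClosure = ⊤ := by
    rw [Submodule.topologicalClosure_eq_top_iff, ContinuousLinearMap.orthogonal_range,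
      ← ContinuousLinearMap.star_eq_adjoint, hsa.star_eq, LinearMap.ker_eq_bot']
    intro f hf
    apply hR
    rw [map_zero]
    conv_lhs => rw [← regPow_mul_regPowRes h0 h1 hε hs]
    rw [mul_apply_eq_comp, show regPowRes R ε s f = 0 from hf, map_zero]
  have := (Submodule.dense_iff_topologicalClosure_eq_top).2 hker
  exact this

/-- Turns a bound relative to A^s into an operator norm bound uniform in ε: on the dense set of
vectors (ε + A)^s R f the composition is S R f, and A^s ≤ (ε + A)^s. -/
lemma norm_comp_regPow_le (h0 : 0 ≤ R) (h1 : R ≤ 1) (hR : Function.Injective R)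
    (hε : ε ∈ Ioo (0 : ℝ) 1) (hs : s ∈ Icc (0 : ℝ) 1) {S : H →L[ℂ] K} {M : ℝ} (hM : 0 ≤ M)
    (h : ∀ f, ‖S (R f)‖ ≤ M * ‖powRes R s f‖) : ‖S ∘L regPow R ε s‖ ≤ M := by
  refine ContinuousLinearMap.opNorm_le_bound _ hM fun g => ?_
  refine (denseRange_regPowRes h0 h1 hR hε hs).induction_on
    (p := fun g => ‖(S ∘L regPow R ε s) g‖ ≤ M * ‖g‖) g ?_ ?_
  · exact isClosed_le (by fun_prop) (by fun_prop)
  · intro f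
    have e : (S ∘L regPow R ε s) (regPowRes R ε s f) = S (R f) := by
      conv_rhs => rw [← regPow_mul_regPowRes h0 h1 hε hs]
      rfl
    rw [e]
    exact (h f).trans (by gcongr; exact norm_powRes_apply_le h0 h1 hε hs f)

/-- The symbols converge uniformly on [0, 1] with error at most ε^s, since t ↦ t^s is subadditive
for s ≤ 1. -/
lemma tendsto_regPowRes (h0 : 0 ≤ R) (h1 : R ≤ 1) (hs : s ∈ Ioc (0 : ℝ) 1) :
    Filter.Tendsto (fun ε : ℝ => regPowRes R ε s) (nhdsWithin 0 (Ioi 0)) (nhds (powRes R s)) := by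
  have hs' : s ∈ Icc (0 : ℝ) 1 := ⟨hs.1.le, hs.2⟩
  have hsub := spectrum_subset_Icc h0 h1
  refine tendsto_cfc_fun ?_ (Filter.Eventually.of_forall fun ε => continuousOn_regPowRes_symbol hs')
  rw [Metric.tendstoUniformlyOn_iff]
  intro δ hδ
  have hlim : Filter.Tendsto (fun ε : ℝ => ε ^ s) (nhdsWithin 0 (Ioi 0)) (nhds 0) := by
    have : Filter.Tendsto (fun ε : ℝ => ε ^ s) (nhds 0) (nhds ((0 : ℝ) ^ s)) :=
      (Real.continuousAt_rpow_const 0 s (Or.inr hs.1.le))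
    rw [Real.zero_rpow hs.1.ne'] at this
    exact this.mono_left nhdsWithin_le_nhds
  filter_upwards [hlim.eventually (gt_mem_nhds hδ), self_mem_nhdsWithin] with ε hε hε0 x hx
  have hε0' : 0 < ε := hε0
  have hx0 := (hsub hx).1
  have hx1 : 0 ≤ 1 - x := by linarith [(hsub hx).2]
  refine lt_of_le_of_lt ?_ hε
  rw [Real.dist_eq, ← mul_sub, abs_mul, abs_of_nonneg (Real.rpow_nonneg hx0 _)]
  have e : 1 - (1 - ε) * x = (1 - x) + ε * x := by ring
  have b1 : (1 - (1 - ε) * x) ^ s ≤ (1 - x) ^ s + (ε * x) ^ s := by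
    rw [e]; exact Real.rpow_add_le_add_rpow hx1 (by positivity) hs.1.le hs.2
  have b2 : (1 - x) ^ s ≤ (1 - (1 - ε) * x) ^ s :=
    Real.rpow_le_rpow hx1 (by rw [e]; nlinarith) hs.1.le
  have b3 : (ε * x) ^ s ≤ ε ^ s :=
    Real.rpow_le_rpow (by positivity) (by nlinarith [(hsub hx).2]) hs.1.le
  have b4 : x ^ (1 - s) ≤ 1 := Real.rpow_le_one hx0 (hsub hx).2 (by linarith [hs.2])
  have b5 : |(1 - x) ^ s - (1 - (1 - ε) * x) ^ s| ≤ ε ^ s := by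
    rw [abs_sub_le_iff]
    constructor
    · linarith [Real.rpow_nonneg hε0'.le s]
    · linarith
  calc _ ≤ 1 * ε ^ s := mul_le_mul b4 b5 (abs_nonneg _) zero_le_one
    _ = ε ^ s := one_mul _

/-- Converse of `norm_comp_regPow_le`: apply the uniform bound to (ε + A)^s R f and let ε → 0. -/
lemma norm_apply_le_of_norm_comp_regPow_le (h0 : 0 ≤ R) (h1 : R ≤ 1) (hs : s ∈ Ioc (0 : ℝ) 1)
    {S : H →L[ℂ] K} {C : ℝ} (h : ∀ ε ∈ Ioo (0 : ℝ) 1, ‖S ∘L regPow R ε s‖ ≤ C) (f : H) :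
    ‖S (R f)‖ ≤ C * ‖powRes R s f‖ := by
  have hlim : Filter.Tendsto (fun ε : ℝ => C * ‖regPowRes R ε s f‖) (nhdsWithin 0 (Ioi 0))
      (nhds (C * ‖powRes R s f‖)) := by
    refine Filter.Tendsto.const_mul _ (Filter.Tendsto.norm ?_)
    exact ((ContinuousLinearMap.apply ℂ H f).continuous.tendsto _).comp
      (tendsto_regPowRes h0 h1 hs)
  refine ge_of_tendsto hlim ?_
  filter_upwards [Ioo_mem_nhdsGT (zero_lt_one' ℝ)] with ε hε
  have e : S (R f) = (S ∘L regPow R ε s) (regPowRes R ε s f) := by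
    conv_lhs => rw [← regPow_mul_regPowRes h0 h1 hε ⟨hs.1.le, hs.2⟩]
    rfl
  rw [e]
  exact (ContinuousLinearMap.le_opNorm _ _).trans (by gcongr; exact h ε hε)

open ContinuousLinearMap in
/-- Interpolation between two bounds of `S s` by the power `A ^ s`, where `R = (1 + A)⁻¹` and the
bounded operators `S s` behave as the powers of a non-negative operator. -/
lemma norm_apply_le_interpolate [CompleteSpace K] (h0 : 0 ≤ R) (h1 : R ≤ 1)
    (hR : Function.Injective R)
    {S : ℝ → H →L[ℂ] K} {a b M₀ M₁ C θ : ℝ} (ha : 0 < a) (hab : a ≤ b) (hb : b ≤ 1)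
    (hM₀ : 0 < M₀) (hM₁ : 0 < M₁)
    (hS : ∀ r ∈ Icc a b, ∀ s ∈ Icc a b, ∀ t ∈ Icc a b, s + t = 2 * r →
      adjoint (S r) ∘L S r = adjoint (S s) ∘L S t)
    (hC : ∀ s ∈ Icc a b, ‖S s‖ ≤ C)
    (hSa : ∀ f, ‖S a (R f)‖ ≤ M₀ * ‖powRes R a f‖)
    (hSb : ∀ f, ‖S b (R f)‖ ≤ M₁ * ‖powRes R b f‖) (hθ : θ ∈ Icc (0 : ℝ) 1) (f : H) :
    ‖S ((1 - θ) * a + θ * b) (R f)‖ ≤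
      M₀ ^ (1 - θ) * M₁ ^ θ * ‖powRes R ((1 - θ) * a + θ * b) f‖ := by
  have hunit : ∀ s ∈ Icc a b, s ∈ Icc (0 : ℝ) 1 := fun s hs =>
    ⟨ha.le.trans hs.1, hs.2.trans hb⟩
  have hγ : (1 - θ) * a + θ * b ∈ Ioc (0 : ℝ) 1 := by
    constructor <;> nlinarith [hθ.1, hθ.2]
  refine norm_apply_le_of_norm_comp_regPow_le h0 h1 hγ (fun ε hε => ?_) f
  refine norm_comp_le_interpolate (S := S) (G := regPow R ε) (C := C * ε⁻¹) ha.le hab hM₀ hM₁ hS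
    (fun s _ => isSelfAdjoint_regPow) (fun s t hs ht => regPow_add h0 h1 hε hs ht)
    (fun s hs => ?_) ?_ ?_ hθ
  · refine (opNorm_comp_le _ _).trans ?_
    have := hC s hs
    have h' := norm_regPow_le h0 h1 hε (hunit s hs)
    gcongr
    exact (norm_nonneg _).trans this
  · exact norm_comp_regPow_le h0 h1 hR hε (hunit a ⟨le_rfl, hab⟩) hM₀.le hSa
  · exact norm_comp_regPow_le h0 h1 hR hε (hunit b ⟨hab, le_rfl⟩) hM₁.le hSb

end Regularization

/-! ### Multiplication operators on L² and the Heinz-type inequality for them. -/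

section Multiplication

variable {α : Type*} [MeasurableSpace α] {μ : Measure α}

/-- Multiplication by a bounded function as an operator on `L²`. -/
def mulLp {b : α → ℂ} (hb : MemLp b ∞ μ) : Lp ℂ 2 μ →L[ℂ] Lp ℂ 2 μ :=
  (ContinuousLinearMap.lsmul ℂ ℂ).holderL μ ∞ 2 2 (hb.toLp b)

lemma coeFn_mulLp {b : α → ℂ} (hb : MemLp b ∞ μ) (u : Lp ℂ 2 μ) :
    mulLp hb u =ᵐ[μ] fun x => b x * u x := by
  filter_upwards [(ContinuousLinearMap.lsmul ℂ ℂ).coeFn_holder (r := 2) (hb.toLp b) u,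
    hb.coeFn_toLp] with x hx hx'
  exact hx.trans (by rw [hx']; rfl)

lemma norm_mulLp_le {b : α → ℂ} (hb : MemLp b ∞ μ) {C : ℝ} (hC : 0 ≤ C) (h : ∀ x, ‖b x‖ ≤ C) :
    ‖mulLp hb‖ ≤ C := by
  refine ContinuousLinearMap.opNorm_le_bound _ hC fun u => ?_
  refine Lp.norm_le_mul_norm_of_ae_le_mul ?_
  filter_upwards [coeFn_mulLp hb u] with x hx
  rw [hx, norm_mul]
  gcongr
  exact h x

variable {m : α → ℝ}

lemma memLp_top_min_rpow (hm : AEMeasurable m μ) (h0 : ∀ x, 0 ≤ m x) {k : ℝ} (hk : 1 ≤ k)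
    {s : ℝ} (hs : 0 ≤ s) : MemLp (fun x => ((min (m x) k ^ s : ℝ) : ℂ)) ∞ μ := by
  refine memLp_top_of_bound ?_ (k ^ s) (Filter.Eventually.of_forall fun x => ?_)
  · exact (((hm.min aemeasurable_const).pow_const s).complex_ofReal).aestronglyMeasurable
  · have : 0 ≤ min (m x) k := le_min (h0 x) (by linarith)
    rw [Complex.norm_real, Real.norm_of_nonneg (by positivity)]
    exact Real.rpow_le_rpow this (min_le_right _ _) hs

/-- Fatou's lemma: at each point the truncations are eventually constant. -/
lemma eLpNorm_le_of_min {p : ℝ≥0∞} {u : α → ℂ} (hu : AEStronglyMeasurable u μ)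
    (hm : AEMeasurable m μ) {s : ℝ} {C : ℝ≥0∞}
    (h : ∀ k : ℝ, 1 ≤ k → eLpNorm (fun x => ((min (m x) k ^ s : ℝ) : ℂ) * u x) p μ ≤ C) :
    eLpNorm (fun x => ((m x ^ s : ℝ) : ℂ) * u x) p μ ≤ C := by
  refine (Lp.eLpNorm_lim_le_liminf_eLpNorm
    (f := fun (n : ℕ) x => ((min (m x) (n + 1) ^ s : ℝ) : ℂ) * u x) (fun n => ?_) _
    (Filter.Eventually.of_forall fun x => ?_)).trans ?_
  · exact (((hm.min aemeasurable_const).pow_const s).complex_ofReal).aestronglyMeasurable.mul hu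
  · refine tendsto_const_nhds.congr' ?_
    obtain ⟨N, hN⟩ := exists_nat_ge (m x)
    filter_upwards [Filter.eventually_ge_atTop N] with n hn
    rw [min_eq_left]
    have : (N : ℝ) ≤ n := by exact_mod_cast hn
    linarith
  · refine (Filter.liminf_le_liminf (v := fun _ : ℕ => C)
      (Filter.Eventually.of_forall fun n => h _ (by simp))).trans ?_
    simp

variable {H : Type*} [NormedAddCommGroup H] [InnerProductSpace ℂ H] [CompleteSpace H]

open ContinuousLinearMap in
/-- Heinz-type interpolation: bounds of `m ^ a` and `m ^ b` by `A ^ a` and `A ^ b`, where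
`R = (1 + A)⁻¹`, yield a bound of all intermediate powers. -/
theorem eLpNorm_rpow_mul_le_interpolate {R : H →L[ℂ] H} (h0 : 0 ≤ R) (h1 : R ≤ 1)
    (hR : Function.Injective R) (T : H →L[ℂ] Lp ℂ 2 μ) (hm : AEMeasurable m μ) (hm0 : ∀ x, 0 ≤ m x)
    {a b M₀ M₁ θ : ℝ} (ha : 0 < a) (hab : a ≤ b) (hb : b ≤ 1) (hM₀ : 0 < M₀) (hM₁ : 0 < M₁)
    (hTa : ∀ f, eLpNorm (fun x => ((m x ^ a : ℝ) : ℂ) * T (R f) x) 2 μ ≤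
      ENNReal.ofReal (M₀ * ‖powRes R a f‖))
    (hTb : ∀ f, eLpNorm (fun x => ((m x ^ b : ℝ) : ℂ) * T (R f) x) 2 μ ≤
      ENNReal.ofReal (M₁ * ‖powRes R b f‖)) (hθ : θ ∈ Icc (0 : ℝ) 1) (f : H) :
    eLpNorm (fun x => ((m x ^ ((1 - θ) * a + θ * b) : ℝ) : ℂ) * T (R f) x) 2 μ ≤
      ENNReal.ofReal (M₀ ^ (1 - θ) * M₁ ^ θ * ‖powRes R ((1 - θ) * a + θ * b) f‖) := by
  refine eLpNorm_le_of_min (Lp.aestronglyMeasurable _) hm fun k hk => ?_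
  have hmk : ∀ x, 0 ≤ min (m x) k := fun x => le_min (hm0 x) (by linarith)
  set S : ℝ → H →L[ℂ] Lp ℂ 2 μ := fun s =>
    if hs : 0 ≤ s then mulLp (memLp_top_min_rpow hm hm0 hk hs) ∘L T else 0 with hSdef
  have hScoe : ∀ s, 0 ≤ s → ∀ f, S s f =ᵐ[μ] fun x => ((min (m x) k ^ s : ℝ) : ℂ) * T f x := by
    intro s hs f
    simp only [hSdef, dif_pos hs]
    exact coeFn_mulLp _ _
  have hSnorm : ∀ s, 0 ≤ s → ∀ f, ENNReal.ofReal ‖S s f‖ =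
      eLpNorm (fun x => ((min (m x) k ^ s : ℝ) : ℂ) * T f x) 2 μ := by
    intro s hs f
    rw [ofReal_norm, Lp.enorm_def, eLpNorm_congr_ae (hScoe s hs f)]
  have hbound : ∀ s, 0 ≤ s → ∀ M f, 0 ≤ M →
      eLpNorm (fun x => ((m x ^ s : ℝ) : ℂ) * T f x) 2 μ ≤ ENNReal.ofReal M → ‖S s f‖ ≤ M := by
    intro s hs M f hM h
    rw [← ENNReal.ofReal_le_ofReal_iff hM, hSnorm s hs]
    refine (eLpNorm_mono fun x => ?_).trans h
    rw [norm_mul, norm_mul, Complex.norm_real, Complex.norm_real,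
      Real.norm_of_nonneg (Real.rpow_nonneg (hmk x) _),
      Real.norm_of_nonneg (Real.rpow_nonneg (hm0 x) _)]
    gcongr
    · exact hmk x
    · exact min_le_left _ _
  have hγ0 : 0 ≤ (1 - θ) * a + θ * b := by nlinarith [hθ.1, hθ.2]
  rw [← hSnorm _ hγ0]
  refine ENNReal.ofReal_le_ofReal ?_
  refine norm_apply_le_interpolate (C := k * ‖T‖) h0 h1 hR ha hab hb hM₀ hM₁ ?_ ?_
    (fun f => hbound a ha.le _ _ (by positivity) (hTa f))
    (fun f => hbound b (ha.le.trans hab) _ _ (by positivity) (hTb f)) hθ f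
  -- Multiplications by real functions are symmetric and commute, so the identity reduces pointwise
  -- to 2r = s + t in the exponents.
  · intro r hr s hs t ht hst
    have hr0 := ha.le.trans hr.1
    have hs0 := ha.le.trans hs.1
    have ht0 := ha.le.trans ht.1
    refine ContinuousLinearMap.ext fun u => ext_inner_left ℂ fun v => ?_
    rw [comp_apply, comp_apply, adjoint_inner_right, adjoint_inner_right, L2.inner_def,
      L2.inner_def]
    refine integral_congr_ae ?_
    filter_upwards [hScoe r hr0 u, hScoe r hr0 v, hScoe s hs0 v, hScoe t ht0 u] with x e1 e2 e3 e4
    rw [e1, e2, e3, e4]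
    simp only [RCLike.inner_apply, map_mul, Complex.conj_ofReal]
    have e : ((min (m x) k ^ r : ℝ) : ℂ) * ((min (m x) k ^ r : ℝ) : ℂ) =
        ((min (m x) k ^ s : ℝ) : ℂ) * ((min (m x) k ^ t : ℝ) : ℂ) := by
      rw [← Complex.ofReal_mul, ← Complex.ofReal_mul, ← Real.rpow_add_of_nonneg (hmk x) hr0 hr0,
        ← Real.rpow_add_of_nonneg (hmk x) hs0 ht0, hst, two_mul]
    linear_combination (T u x * conj (T v x)) * e
  · intro s hs
    have hs0 := ha.le.trans hs.1
    simp only [hSdef, dif_pos hs0]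
    refine (opNorm_comp_le _ _).trans ?_
    gcongr
    refine norm_mulLp_le _ (by linarith) fun x => ?_
    rw [Complex.norm_real, Real.norm_of_nonneg (Real.rpow_nonneg (hmk x) _)]
    -- The bound is uniform in s because k ≥ 1 and s ≤ 1.
    calc _ ≤ k ^ s := Real.rpow_le_rpow (hmk x) (min_le_right _ _) hs0
      _ ≤ k ^ (1 : ℝ) := Real.rpow_le_rpow_of_exponent_le hk (hs.2.trans hb)
      _ = k := Real.rpow_one k

end Multiplication

/-! ### Weak derivatives, their closedness and their Fourier side. -/

section WeakDerivative

variable {n : ℕ}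

lemma toTemperedDistribution_injective :
    Function.Injective (Lp.toTemperedDistributionCLM ℂ (volume : Measure (Rn n)) 2) :=
  LinearMap.ker_eq_bot.1 Lp.ker_toTemperedDistributionCLM_eq_bot

lemma mem_weakDerivGraph {i : Fin n} {p : L2 n × L2 n} :
    p ∈ weakDerivGraph n i ↔
      ∂_{EuclideanSpace.single i (1 : ℝ)} (p.1 : 𝓢'(Rn n, ℂ)) = (p.2 : 𝓢'(Rn n, ℂ)) := Iff.rfl

lemma isClosed_weakDerivGraph (i : Fin n) :
    IsClosed (weakDerivGraph n i : Set (L2 n × L2 n)) := by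
  have h1 : Continuous fun p : L2 n × L2 n =>
      ∂_{EuclideanSpace.single i (1 : ℝ)} (p.1 : 𝓢'(Rn n, ℂ)) :=
    (LineDeriv.continuous_lineDerivOp _).comp
      ((Lp.toTemperedDistributionCLM ℂ (volume : Measure (Rn n)) 2).continuous.comp continuous_fst)
  have h2 : Continuous fun p : L2 n × L2 n => (p.2 : 𝓢'(Rn n, ℂ)) :=
    (Lp.toTemperedDistributionCLM ℂ (volume : Measure (Rn n)) 2).continuous.comp continuous_snd
  exact isClosed_eq h1 h2

lemma weakDeriv_graph (i : Fin n) : (weakDeriv n i).graph = weakDerivGraph n i := by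
  refine Submodule.toLinearPMap_graph_eq _ fun p hp h0 => ?_
  rw [mem_weakDerivGraph, h0] at hp
  apply toTemperedDistribution_injective
  rw [map_zero, Lp.toTemperedDistributionCLM_apply, ← hp, ← Lp.toTemperedDistributionCLM_apply,
    map_zero]
  exact (LineDeriv.lineDerivOpCLM ℂ 𝓢'(Rn n, ℂ) (EuclideanSpace.single i (1 : ℝ))).map_zero

lemma mem_weakDeriv_domain {i : Fin n} {u g : L2 n} (h : (u, g) ∈ weakDerivGraph n i) :
    u ∈ (weakDeriv n i).domain := by
  rw [← weakDeriv_graph] at h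
  exact LinearPMap.mem_domain_of_mem_graph h

lemma partialD_mem_graph (V : Rn n → ℂ) (i : Fin n) (u : H1V V) :
    ((u : L2 n), partialD V i u) ∈ weakDerivGraph n i := by
  rw [← weakDeriv_graph]
  exact LinearPMap.mem_graph _ (Submodule.inclusion
    (inf_le_left.trans (iInf_le (fun i => (weakDeriv n i).domain) i)) u)

lemma partialD_eq {V : Rn n → ℂ} {i : Fin n} {u : H1V V} {g : L2 n}
    (h : ((u : L2 n), g) ∈ weakDerivGraph n i) : partialD V i u = g := by
  have h' := partialD_mem_graph V i u
  rw [mem_weakDerivGraph] at h h'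
  apply toTemperedDistribution_injective
  exact h'.symm.trans h

lemma schwartz_mem_weakDerivGraph (φ : 𝓢(Rn n, ℂ)) (i : Fin n) :
    (φ.toLp 2 volume, (∂_{EuclideanSpace.single i (1 : ℝ)} φ).toLp 2 volume) ∈
      weakDerivGraph n i := by
  rw [mem_weakDerivGraph, Lp.toTemperedDistribution_toLp_eq, Lp.toTemperedDistribution_toLp_eq,
    TemperedDistribution.lineDerivOp_toTemperedDistributionCLM_eq]

/-- The Fourier transform turns a weak derivative into a multiplication. -/
lemma fourier_ae_eq_of_mem_weakDerivGraph {i : Fin n} {u g : L2 n}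
    (h : (u, g) ∈ weakDerivGraph n i) :
    (𝓕 g : L2 n) =ᵐ[volume] fun ξ => (2 * Real.pi * Complex.I) * (ξ i : ℂ) * (𝓕 u : L2 n) ξ := by
  rw [mem_weakDerivGraph] at h
  have hloc : ∀ f : L2 n, LocallyIntegrable f volume := fun f =>
    (Lp.memLp f).locallyIntegrable (by norm_num)
  have hloc2 : LocallyIntegrable
      (fun ξ => (2 * Real.pi * Complex.I) * (ξ i : ℂ) * (𝓕 u : L2 n) ξ) volume := by
    have := (hloc (𝓕 u : L2 n)).smul_continuous (g := fun ξ : Rn n =>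
      (2 * Real.pi * Complex.I) * (ξ i : ℂ)) (by fun_prop)
    refine this.congr (Filter.Eventually.of_forall fun ξ => ?_)
    simp only [smul_eq_mul, mul_comm]
  have hdist : 𝓕 (g : 𝓢'(Rn n, ℂ)) = (2 * Real.pi * Complex.I) •
      TemperedDistribution.smulLeftCLM ℂ
        (fun x : Rn n => ((inner ℝ x (EuclideanSpace.single i (1 : ℝ)) : ℝ) : ℂ))
        (𝓕 (u : 𝓢'(Rn n, ℂ))) := by
    rw [← h]; exact TemperedDistribution.fourier_lineDerivOp_eq _ _
  rw [Lp.fourier_toTemperedDistribution_eq, Lp.fourier_toTemperedDistribution_eq] at hdist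
  -- An identity of distributions between locally integrable functions becomes an a.e. identity by
  -- testing against smooth functions of compact support.
  have hzero : ∀ᵐ ξ ∂(volume : Measure (Rn n)), (𝓕 g : L2 n) ξ -
      (2 * Real.pi * Complex.I) * (ξ i : ℂ) * (𝓕 u : L2 n) ξ = 0 := by
    refine ae_eq_zero_of_integral_contDiff_smul_eq_zero ((hloc _).sub hloc2) fun φ hφ hφc => ?_
    have hc₁ : HasCompactSupport (Complex.ofRealCLM ∘ φ) := hφc.comp_left rfl
    have hc₂ : ContDiff ℝ (⊤ : ℕ∞) (Complex.ofRealCLM ∘ φ) := Complex.ofRealCLM.contDiff.comp hφ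
    have e := DFunLike.congr_fun hdist (hc₁.toSchwartzMap hc₂)
    have hg : Function.HasTemperateGrowth fun x : Rn n =>
        ((inner ℝ x (EuclideanSpace.single i (1 : ℝ)) : ℝ) : ℂ) := by fun_prop
    have hRe : ∀ ξ, (hc₁.toSchwartzMap hc₂) ξ = (φ ξ : ℂ) := fun ξ => rfl
    simp only [Lp.toTemperedDistribution_apply, hRe, smul_apply, smul_eq_mul,
      TemperedDistribution.smulLeftCLM_apply_apply, SchwartzMap.smulLeftCLM_apply_apply hg] at e
    simp only [EuclideanSpace.inner_single_right, one_mul, conj_trivial] at e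
    have i1 := (hloc (𝓕 g : L2 n)).integrable_smul_left_of_hasCompactSupport hφ.continuous hφc
    have i2 := hloc2.integrable_smul_left_of_hasCompactSupport hφ.continuous hφc
    simp only [Complex.real_smul] at i1 i2
    simp only [Complex.real_smul, mul_sub]
    rw [integral_sub i1 i2, e, ← integral_const_mul, sub_eq_zero]
    refine integral_congr_ae (Filter.Eventually.of_forall fun ξ => ?_)
    ring
  filter_upwards [hzero] with ξ hξ
  exact sub_eq_zero.1 hξ

lemma eLpNorm_two_sq {α : Type*} [MeasurableSpace α] {μ : Measure α} (f : α → ℂ) :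
    eLpNorm f 2 μ ^ 2 = ∫⁻ x, ‖f x‖ₑ ^ 2 ∂μ := by
  have := eLpNorm_nnreal_pow_eq_lintegral (μ := μ) (f := f) (p := 2) (by norm_num)
  simpa using this

/-- Plancherel for each component of the gradient, with Σ (2πξᵢ)² = (2π|ξ|)². -/
lemma lapNorm_half_sq_le {u : L2 n} {g : Fin n → L2 n}
    (h : ∀ i, (u, g i) ∈ weakDerivGraph n i) :
    lapNorm (1 / 2) u ^ 2 ≤ ENNReal.ofReal (∑ i, ‖g i‖ ^ 2) := by
  have hg : ∀ i, ENNReal.ofReal (‖g i‖ ^ 2) = ∫⁻ ξ, ‖(𝓕 (g i) : L2 n) ξ‖ₑ ^ 2 := by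
    intro i
    rw [← Lp.norm_fourier_eq, ENNReal.ofReal_pow (norm_nonneg _), ofReal_norm, Lp.enorm_def,
      eLpNorm_two_sq]
  rw [lapNorm, eLpNorm_two_sq, ENNReal.ofReal_sum_of_nonneg (fun i _ => by positivity)]
  simp only [hg]
  rw [← lintegral_finsetSum' _ fun i _ => (Lp.aestronglyMeasurable _).enorm.pow_const 2]
  refine lintegral_mono_ae ?_
  filter_upwards [ae_all_iff.2 fun i => fourier_ae_eq_of_mem_weakDerivGraph (h i)] with ξ hξ
  have e : ∀ i, ‖(𝓕 (g i) : L2 n) ξ‖ₑ ^ 2 =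
      ENNReal.ofReal ((2 * Real.pi * |ξ i| * ‖(𝓕 u : L2 n) ξ‖) ^ 2) := by
    intro i
    rw [hξ i, ← ofReal_norm, ← ENNReal.ofReal_pow (norm_nonneg _)]
    congr 2
    simp [abs_of_pos Real.pi_pos]
  simp only [e]
  rw [← ENNReal.ofReal_sum_of_nonneg (fun i _ => by positivity), ← ofReal_norm,
    ← ENNReal.ofReal_pow (norm_nonneg _)]
  refine ENNReal.ofReal_le_ofReal (le_of_eq ?_)
  have e2 : (2 * Real.pi * ‖ξ‖) ^ (2 * (1 / 2 : ℝ)) = 2 * Real.pi * ‖ξ‖ := by norm_num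
  rw [e2, norm_mul, Complex.norm_real, Real.norm_of_nonneg (by positivity)]
  simp only [mul_pow, sq_abs]
  rw [← Finset.sum_mul, ← Finset.mul_sum, EuclideanSpace.real_norm_sq_eq]

end WeakDerivative

/-! ### The form, its closedness, and existence of the resolvent. -/

section Form

variable {n : ℕ} {V : Rn n → ℂ}

lemma memLp_sqrt (u : H1V V) :
    MemLp (fun x => ((‖V x‖ ^ (1 / 2 : ℝ) : ℝ) : ℂ) * (u : L2 n) x) 2 volume := u.2.2

/-- `|V|^{1/2} u` for `u` in the form domain. -/
def sqrtMul (V : Rn n → ℂ) (u : H1V V) : L2 n := (memLp_sqrt u).toLp _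

lemma coeFn_sqrtMul (u : H1V V) :
    sqrtMul V u =ᵐ[volume] fun x => ((‖V x‖ ^ (1 / 2 : ℝ) : ℝ) : ℂ) * (u : L2 n) x :=
  (memLp_sqrt u).coeFn_toLp

lemma form_eq (u v : H1V V) : form V u v =
    (∑ i : Fin n, ⟪partialD V i v, partialD V i u⟫_ℂ) + ⟪sqrtMul V v, sqrtMul V u⟫_ℂ := by
  rw [form, L2.inner_def]
  congr 1
  refine integral_congr_ae ?_
  filter_upwards [coeFn_sqrtMul u, coeFn_sqrtMul v] with x h1 h2
  rw [h1, h2]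
  have h : (‖V x‖ ^ (1 / 2 : ℝ)) * (‖V x‖ ^ (1 / 2 : ℝ)) = ‖V x‖ := by
    rw [← Real.sqrt_eq_rpow, Real.mul_self_sqrt (norm_nonneg _)]
  have h' : ((‖V x‖ ^ (1 / 2 : ℝ) : ℝ) : ℂ) * ((‖V x‖ ^ (1 / 2 : ℝ) : ℝ) : ℂ) = (‖V x‖ : ℂ) := by
    exact_mod_cast h
  simp only [RCLike.inner_apply, map_mul, Complex.conj_ofReal]
  rw [← h']
  ring

lemma form_conj (u v : H1V V) : conj (form V u v) = form V v u := by
  simp only [form_eq, map_add, map_sum, inner_conj_symm]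

lemma form_self (u : H1V V) :
    form V u u = ((∑ i : Fin n, ‖partialD V i u‖ ^ 2 + ‖sqrtMul V u‖ ^ 2 : ℝ) : ℂ) := by
  simp [form_eq, inner_self_eq_norm_sq_to_K]

lemma form_self_re_nonneg (u : H1V V) : 0 ≤ (form V u u).re := by
  rw [form_self, Complex.ofReal_re]
  positivity

/-- Local integrability of V enters here: |V||φ|² is integrable for φ of compact support. -/
lemma schwartz_mem_H1V (hV : LocallyIntegrable V volume) (φ : 𝓢(Rn n, ℂ))
    (hφ : HasCompactSupport φ) : φ.toLp 2 volume ∈ H1V V := by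
  refine ⟨(Submodule.mem_iInf _).2 fun i =>
    mem_weakDeriv_domain (schwartz_mem_weakDerivGraph φ i), ?_⟩
  have hm : AEStronglyMeasurable (fun x => ((‖V x‖ ^ (1 / 2 : ℝ) : ℝ) : ℂ) * φ x) volume :=
    ((hV.aestronglyMeasurable.norm.aemeasurable.pow_const _).complex_ofReal).aestronglyMeasurable.mul
      φ.continuous.aestronglyMeasurable
  have h2 : MemLp (fun x => ((‖V x‖ ^ (1 / 2 : ℝ) : ℝ) : ℂ) * φ x) 2 volume := by
    rw [memLp_two_iff_integrable_sq_norm hm]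
    have hc : HasCompactSupport fun x => ‖φ x‖ ^ 2 := by
      refine hφ.comp_left (g := fun z : ℂ => ‖z‖ ^ 2) (by simp)
    have := hV.integrable_smul_left_of_hasCompactSupport
      (φ.continuous.norm.pow 2 : Continuous fun x => ‖φ x‖ ^ 2) hc
    refine this.norm.congr (Filter.Eventually.of_forall fun x => ?_)
    have e : ‖((‖V x‖ ^ (1 / 2 : ℝ) : ℝ) : ℂ)‖ ^ 2 = ‖V x‖ := by
      rw [Complex.norm_real, ← Real.sqrt_eq_rpow, Real.norm_of_nonneg (Real.sqrt_nonneg _),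
        Real.sq_sqrt (norm_nonneg _)]
    change ‖‖φ x‖ ^ 2 • V x‖ = ‖((‖V x‖ ^ (1 / 2 : ℝ) : ℝ) : ℂ) * φ x‖ ^ 2
    rw [norm_mul, mul_pow, e, mul_comm, norm_smul, norm_pow, norm_norm]
  refine h2.ae_eq ?_
  filter_upwards [φ.coeFn_toLp 2 volume] with x hx
  rw [hx]

/-- `toLinearPMap` keeps the given graph only if it is single-valued. If u = 0, then w is orthogonal
to all test functions, which belong to the form domain, so w = 0. -/
lemma schrodinger_graph (hV : LocallyIntegrable V volume) :
    (schrodinger V).graph = schrodingerGraph V := by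
  refine Submodule.toLinearPMap_graph_eq _ ?_
  rintro ⟨u, w⟩ ⟨hu, h⟩ (rfl : u = 0)
  rw [Lp.eq_zero_iff_ae_eq_zero]
  refine ae_eq_zero_of_integral_contDiff_smul_eq_zero
    ((Lp.memLp w).locallyIntegrable (by norm_num)) fun φ hφ hφc => ?_
  have hc₁ : HasCompactSupport (Complex.ofRealCLM ∘ φ) := hφc.comp_left rfl
  have hc₂ : ContDiff ℝ (⊤ : ℕ∞) (Complex.ofRealCLM ∘ φ) := Complex.ofRealCLM.contDiff.comp hφ
  set ψ := hc₁.toSchwartzMap hc₂ with hψ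
  have h0 : form V ⟨0, hu⟩ ⟨ψ.toLp 2 volume, schwartz_mem_H1V hV ψ hc₁⟩ = 0 := by
    have := form_smul V 0 ⟨0, hu⟩ ⟨ψ.toLp 2 volume, schwartz_mem_H1V hV ψ hc₁⟩
    rw [zero_smul, zero_mul] at this
    exact this
  have := h ⟨ψ.toLp 2 volume, schwartz_mem_H1V hV ψ hc₁⟩
  rw [h0, L2.inner_def] at this
  rw [this]
  refine integral_congr_ae ?_
  filter_upwards [ψ.coeFn_toLp 2 volume] with x hx
  rw [hx, show ψ x = (φ x : ℂ) from rfl]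
  simp [mul_comm]

/-- The graph of the multiplication operator by `|V|^{1/2}`. -/
def sqrtGraph (V : Rn n → ℂ) : Submodule ℂ (L2 n × L2 n) where
  carrier := {p | p.2 =ᵐ[volume] fun x => ((‖V x‖ ^ (1 / 2 : ℝ) : ℝ) : ℂ) * p.1 x}
  add_mem' := by
    rintro p q hp hq
    filter_upwards [hp, hq, Lp.coeFn_add p.1 q.1, Lp.coeFn_add p.2 q.2] with x h1 h2 h3 h4
    rw [Prod.fst_add, Prod.snd_add, h3, h4, Pi.add_apply, Pi.add_apply, h1, h2, mul_add]
  zero_mem' := by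
    filter_upwards [Lp.coeFn_zero ℂ 2 (volume : Measure (Rn n))] with x hx
    rw [Prod.fst_zero, Prod.snd_zero, hx, Pi.zero_apply, mul_zero]
  smul_mem' := by
    rintro c p hp
    filter_upwards [hp, Lp.coeFn_smul c p.1, Lp.coeFn_smul c p.2] with x h1 h2 h3
    rw [Prod.smul_fst, Prod.smul_snd, h2, h3, Pi.smul_apply, Pi.smul_apply, h1, smul_eq_mul,
      smul_eq_mul]
    ring

lemma isClosed_sqrtGraph (hV : AEStronglyMeasurable V volume) :
    IsClosed (sqrtGraph V : Set (L2 n × L2 n)) := by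
  set s : Rn n → ℝ := fun x => ‖V x‖ ^ (1 / 2 : ℝ) with hs
  have hs0 : ∀ x, 0 ≤ s x := fun x => by positivity
  have hsm : AEMeasurable s volume := hV.norm.aemeasurable.pow_const _
  have hb₁ : MemLp (fun x => ((1 / (1 + s x) : ℝ) : ℂ)) ∞ volume := by
    refine memLp_top_of_bound ?_ 1 (Filter.Eventually.of_forall fun x => ?_)
    · exact ((aemeasurable_const.div
        (hsm.const_add 1)).complex_ofReal).aestronglyMeasurable
    · rw [Complex.norm_real, Real.norm_of_nonneg (by have := hs0 x; positivity)]
      exact div_le_one_of_le₀ (by linarith [hs0 x]) (by linarith [hs0 x])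
  have hb₂ : MemLp (fun x => ((s x / (1 + s x) : ℝ) : ℂ)) ∞ volume := by
    refine memLp_top_of_bound ?_ 1 (Filter.Eventually.of_forall fun x => ?_)
    · exact ((hsm.div (hsm.const_add 1)).complex_ofReal).aestronglyMeasurable
    · rw [Complex.norm_real, Real.norm_of_nonneg (by have := hs0 x; positivity)]
      exact div_le_one_of_le₀ (by linarith [hs0 x]) (by linarith [hs0 x])
  -- Dividing w = s u by 1 + s expresses the graph through two bounded multipliers, so it is an
  -- equalizer of continuous maps.
  have hset : (sqrtGraph V : Set (L2 n × L2 n)) = {p | mulLp hb₁ p.2 = mulLp hb₂ p.1} := by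
    ext p
    change (p.2 =ᵐ[volume] fun x => (s x : ℂ) * p.1 x) ↔ mulLp hb₁ p.2 = mulLp hb₂ p.1
    refine ⟨fun h => Lp.ext ?_, fun h => ?_⟩
    · filter_upwards [h, coeFn_mulLp hb₁ p.2, coeFn_mulLp hb₂ p.1] with x h1 h2 h3
      rw [h2, h3, h1, ← mul_assoc, ← Complex.ofReal_mul, one_div_mul_eq_div]
    · filter_upwards [coeFn_mulLp hb₁ p.2, coeFn_mulLp hb₂ p.1] with x h2 h3
      rw [h, h3, div_eq_mul_one_div, Complex.ofReal_mul, mul_right_comm, mul_comm] at h2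
      have h1 : ((1 / (1 + s x) : ℝ) : ℂ) ≠ 0 := by
        have := hs0 x
        exact_mod_cast (by positivity : 1 / (1 + s x) ≠ 0)
      exact (mul_left_cancel₀ h1 h2).symm
  rw [hset]
  exact isClosed_eq (by fun_prop) (by fun_prop)

/-- The Hilbert space `L²(ℝⁿ)^{n+2}`. -/
abbrev FormSpace (n : ℕ) : Type := PiLp 2 fun _ : Option (Option (Fin n)) => L2 n

/-- A pair of components of an element of `L²(ℝⁿ)^{n+2}`. -/
def coordPair (j k : Option (Option (Fin n))) : FormSpace n →L[ℂ] L2 n × L2 n :=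
  (PiLp.proj 2 (fun _ => L2 n) j).prod (PiLp.proj 2 (fun _ => L2 n) k)

/-- The closed subspace of all `(u, |V|^{1/2} u, ∇u)` with `u` in the form domain. -/
def formGraph (V : Rn n → ℂ) : Submodule ℂ (FormSpace n) :=
  (⨅ i, (weakDerivGraph n i).comap (coordPair none (some (some i))).toLinearMap) ⊓
    (sqrtGraph V).comap (coordPair none (some none)).toLinearMap

lemma mem_formGraph {z : FormSpace n} : z ∈ formGraph V ↔
    (∀ i, (z none, z (some (some i))) ∈ weakDerivGraph n i) ∧
      z (some none) =ᵐ[volume] fun x => ((‖V x‖ ^ (1 / 2 : ℝ) : ℝ) : ℂ) * z none x := by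
  rw [formGraph, Submodule.mem_inf, Submodule.mem_iInf]
  rfl

lemma isClosed_formGraph (hV : AEStronglyMeasurable V volume) :
    IsClosed (formGraph V : Set (FormSpace n)) := by
  rw [formGraph, Submodule.coe_inf, Submodule.coe_iInf]
  exact (isClosed_iInter fun i =>
    (isClosed_weakDerivGraph i).preimage (coordPair none (some (some i))).continuous).inter
    ((isClosed_sqrtGraph hV).preimage (coordPair none (some none)).continuous)

lemma mem_H1V_of_mem_formGraph {z : FormSpace n}
    (hz : z ∈ formGraph V) : z none ∈ H1V V :=
  ⟨(Submodule.mem_iInf _).2 fun i => mem_weakDeriv_domain ((mem_formGraph.1 hz).1 i),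
    (Lp.memLp (z (some none))).ae_eq (mem_formGraph.1 hz).2⟩

/-- `(u, |V|^{1/2} u, ∇u)` for `u` in the form domain. -/
def toFormGraph (u : H1V V) : formGraph V :=
  ⟨WithLp.toLp 2 fun
    | none => (u : L2 n)
    | some none => sqrtMul V u
    | some (some i) => partialD V i u,
    mem_formGraph.2 ⟨fun i => partialD_mem_graph V i u, coeFn_sqrtMul u⟩⟩

-- The graph norm squared is ‖u‖² + form(u, u), and closedness makes the graph a Hilbert space. With
-- J its projection to u, the adjoint satisfies ⟨v, J*f⟩ = ⟨Jv, f⟩, which is the weak form of (1 +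
-- A)u = f for u = JJ*f; hence JJ* is the resolvent.
open ContinuousLinearMap in
lemma exists_isResolvent_schrodinger (hV : LocallyIntegrable V volume) :
    ∃ R, IsResolvent (schrodinger V) R := by
  have : CompleteSpace (formGraph V) :=
    (isClosed_formGraph hV.aestronglyMeasurable).completeSpace_coe
  set J : formGraph V →L[ℂ] L2 n :=
    (PiLp.proj 2 (fun _ : Option (Option (Fin n)) => L2 n) none) ∘L (formGraph V).subtypeL with hJ
  have hJ' : ∀ z : formGraph V, J z = (z : FormSpace n) none :=
    fun z => rfl
  refine ⟨J ∘L adjoint J, fun f => ?_⟩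
  rw [schrodinger_graph hV]
  set z := adjoint J f with hz
  have hmem : J z ∈ H1V V := mem_H1V_of_mem_formGraph z.2
  refine ⟨hmem, fun v => ?_⟩
  have h1 : ⟪toFormGraph v, z⟫_ℂ = ⟪(v : L2 n), f⟫_ℂ := by
    rw [hz, adjoint_inner_right]
    rfl
  have hD : ∀ i, partialD V i ⟨J z, hmem⟩ =
      (z : FormSpace n) (some (some i)) := fun i =>
    partialD_eq ((mem_formGraph.1 z.2).1 i)
  have hs : sqrtMul V ⟨J z, hmem⟩ =
      (z : FormSpace n) (some none) :=
    Lp.ext ((coeFn_sqrtMul _).trans (mem_formGraph.1 z.2).2.symm)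
  rw [Submodule.coe_inner, PiLp.inner_apply, Fintype.sum_option, Fintype.sum_option] at h1
  change form V ⟨J z, hmem⟩ v = ⟪(v : L2 n), f - J z⟫_ℂ
  rw [inner_sub_right, ← h1, form_eq, hs]
  simp only [hD]
  change _ = ⟪(v : L2 n), J z⟫_ℂ + (⟪sqrtMul V v, _⟫_ℂ + ∑ i, ⟪partialD V i v, _⟫_ℂ) -
    ⟪(v : L2 n), J z⟫_ℂ
  ring

end Form

/-! ### Fractional powers of A on the range of the resolvent. -/

section FractionalPowerGraph

variable {H : Type*} [NormedAddCommGroup H] [InnerProductSpace ℂ H] [CompleteSpace H]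

lemma rpow_eq_cfc {R : H →L[ℂ] H} (h0 : 0 ≤ R) (γ : ℝ) :
    CFC.rpow R γ = cfc (fun x : ℝ => x ^ γ) R := CFC.rpow_eq_cfc_real h0

lemma one_sub_eq_cfc {R : H →L[ℂ] H} (h0 : 0 ≤ R) : 1 - R = cfc (fun x : ℝ => 1 - x) R := by
  have := h0.isSelfAdjoint
  rw [cfc_sub (fun _ => (1 : ℝ)) (fun x => x) R, cfc_const_one ℝ R, cfc_id' ℝ R]

lemma one_sub_rpow_eq_cfc {R : H →L[ℂ] H} (h0 : 0 ≤ R) (h1 : R ≤ 1) {γ : ℝ} (hγ : 0 ≤ γ) :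
    CFC.rpow (1 - R) γ = cfc (fun x : ℝ => (1 - x) ^ γ) R := by
  rw [rpow_eq_cfc (sub_nonneg.2 h1), one_sub_eq_cfc h0,
    ← cfc_comp' (fun x : ℝ => x ^ γ) (fun x => 1 - x) R
      (continuousOn_id.rpow_const fun _ _ => Or.inr hγ) (by fun_prop) h0.isSelfAdjoint]

variable {A : H →ₗ.[ℂ] H} {γ : ℝ}

lemma rpow_resolvent_mul (h0 : 0 ≤ resolvent A) (h1 : resolvent A ≤ 1) (hγ : γ ∈ Icc (0 : ℝ) 1) :
    CFC.rpow (resolvent A) (1 - γ) * CFC.rpow (resolvent A) γ = resolvent A := by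
  have hsub := spectrum_subset_Icc h0 h1
  rw [rpow_eq_cfc h0, rpow_eq_cfc h0, ← cfc_mul (fun x : ℝ => x ^ (1 - γ)) (fun x => x ^ γ) _
    (continuousOn_id.rpow_const fun _ _ => Or.inr (by linarith [hγ.2]))
    (continuousOn_id.rpow_const fun _ _ => Or.inr hγ.1)]
  conv_rhs => rw [← cfc_id' ℝ (resolvent A) h0.isSelfAdjoint]
  refine cfc_congr fun x hx => ?_
  change x ^ (1 - γ) * x ^ γ = x
  rw [← Real.rpow_add_of_nonneg (hsub hx).1 (by linarith [hγ.2]) hγ.1]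
  simp

/-- The graph is single-valued because R^γ is injective, being a right factor of the injective R =
R^{1-γ}R^γ. -/
lemma mem_fracPow_graph_iff (h0 : 0 ≤ resolvent A) (h1 : resolvent A ≤ 1)
    (hinj : Function.Injective (resolvent A)) (hγ : γ ∈ Icc (0 : ℝ) 1) {u w : H} :
    (u, w) ∈ (fracPow A γ).graph ↔
      CFC.rpow (1 - resolvent A) γ u = CFC.rpow (resolvent A) γ w := by
  rw [fracPow, Submodule.toLinearPMap_graph_eq]
  · rw [LinearMap.mem_ker, LinearMap.sub_apply, sub_eq_zero]
    rfl
  · rintro ⟨x, y⟩ h (rfl : x = 0)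
    rw [LinearMap.mem_ker, LinearMap.sub_apply, sub_eq_zero] at h
    have h' : CFC.rpow (resolvent A) γ y = 0 := by
      refine (Eq.symm ?_ : _ = _)
      simpa using h
    apply hinj
    rw [map_zero]
    conv_lhs => rw [← rpow_resolvent_mul h0 h1 hγ]
    rw [mul_apply_eq_comp, h', map_zero]

lemma powRes_mem_fracPow_graph (h0 : 0 ≤ resolvent A) (h1 : resolvent A ≤ 1)
    (hinj : Function.Injective (resolvent A)) (hγ : γ ∈ Icc (0 : ℝ) 1) (f : H) :
    (resolvent A f, powRes (resolvent A) γ f) ∈ (fracPow A γ).graph := by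
  rw [mem_fracPow_graph_iff h0 h1 hinj hγ]
  have c1 : ContinuousOn (fun x : ℝ => (1 - x) ^ γ) (spectrum ℝ (resolvent A)) :=
    ContinuousOn.rpow_const (by fun_prop) fun _ _ => Or.inr hγ.1
  have c2 : ContinuousOn (fun x : ℝ => x ^ (1 - γ)) (spectrum ℝ (resolvent A)) :=
    continuousOn_id.rpow_const fun _ _ => Or.inr (by linarith [hγ.2])
  have e : CFC.rpow (resolvent A) γ * powRes (resolvent A) γ =
      CFC.rpow (1 - resolvent A) γ * resolvent A := by
    have e1 : powRes (resolvent A) γ =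
        CFC.rpow (resolvent A) (1 - γ) * CFC.rpow (1 - resolvent A) γ := by
      rw [one_sub_rpow_eq_cfc h0 h1 hγ.1, rpow_eq_cfc h0, powRes, cfc_mul _ _ _ c2 c1]
    have e2 : Commute (CFC.rpow (resolvent A) γ) (CFC.rpow (resolvent A) (1 - γ)) := by
      rw [rpow_eq_cfc h0, rpow_eq_cfc h0]
      exact cfc_commute_cfc _ _ _
    have e3 : Commute (resolvent A) (CFC.rpow (1 - resolvent A) γ) := by
      rw [one_sub_rpow_eq_cfc h0 h1 hγ.1]
      exact (Commute.refl _).cfc_real _ |>.symm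
    rw [e1, ← mul_assoc, e2.eq, rpow_resolvent_mul h0 h1 hγ, e3.eq]
  exact (DFunLike.congr_fun e f).symm

/-- The square of the symbol is x(1 - x). For u = R f the right side is ⟨u, Au⟩, which links A^{1/2}
to the form. -/
lemma norm_powRes_half_sq {R : H →L[ℂ] H} (h0 : 0 ≤ R) (h1 : R ≤ 1) (f : H) :
    ‖powRes R (1 / 2) f‖ ^ 2 = (⟪R f, f - R f⟫_ℂ).re := by
  have hsub := spectrum_subset_Icc h0 h1
  have hsa := h0.isSelfAdjoint
  rw [powRes, norm_cfc_apply_sq (continuousOn_powRes_symbol (by norm_num))]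
  have e : cfc (fun x : ℝ => (x ^ (1 - 1 / 2 : ℝ) * (1 - x) ^ (1 / 2 : ℝ)) *
      (x ^ (1 - 1 / 2 : ℝ) * (1 - x) ^ (1 / 2 : ℝ))) R = R * (1 - R) := by
    rw [one_sub_eq_cfc h0]
    conv_rhs => enter [1]; rw [← cfc_id' ℝ R hsa]
    rw [← cfc_mul _ _ R (by fun_prop) (by fun_prop)]
    refine cfc_congr fun x hx => ?_
    have hx0 := (hsub hx).1
    have hx1 : 0 ≤ 1 - x := by linarith [(hsub hx).2]
    change (x ^ (1 - 1 / 2 : ℝ) * (1 - x) ^ (1 / 2 : ℝ)) *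
      (x ^ (1 - 1 / 2 : ℝ) * (1 - x) ^ (1 / 2 : ℝ)) = x * (1 - x)
    rw [show (1 - 1 / 2 : ℝ) = 1 / 2 by norm_num, ← Real.sqrt_eq_rpow, ← Real.sqrt_eq_rpow,
      mul_mul_mul_comm, Real.mul_self_sqrt hx0, Real.mul_self_sqrt hx1]
  rw [e, mul_apply_eq_comp,
    ← ((ContinuousLinearMap.nonneg_iff_isPositive R).1 h0).inner_left_eq_inner_right]
  rfl

end FractionalPowerGraph

/-! ### Properties of the resolvent of |V| - Δ, and the estimate of the bracket. -/

section Resolvent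

variable {n : ℕ} {V : Rn n → ℂ}

lemma isResolvent_resolvent (hV : LocallyIntegrable V volume) :
    IsResolvent (schrodinger V) (resolvent (schrodinger V)) :=
  Classical.epsilon_spec (exists_isResolvent_schrodinger hV)

lemma form_resolvent (hV : LocallyIntegrable V volume) (f : L2 n) :
    ∃ h : resolvent (schrodinger V) f ∈ H1V V, ∀ v : H1V V,
      form V ⟨_, h⟩ v = ⟪(v : L2 n), f - resolvent (schrodinger V) f⟫_ℂ := by
  have := isResolvent_resolvent hV f
  rw [schrodinger_graph hV] at this
  exact this

lemma inner_resolvent_sub_re_nonneg (hV : LocallyIntegrable V volume) (f : L2 n) :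
    0 ≤ (⟪resolvent (schrodinger V) f, f - resolvent (schrodinger V) f⟫_ℂ).re := by
  obtain ⟨h, hf⟩ := form_resolvent hV f
  rw [← hf ⟨_, h⟩]
  exact form_self_re_nonneg _

/-- Both sides come from testing the equation for one resolvent against the other, using that the
form is Hermitian. -/
lemma isSymmetric_resolvent (hV : LocallyIntegrable V volume) (f g : L2 n) :
    ⟪resolvent (schrodinger V) f, g⟫_ℂ = ⟪f, resolvent (schrodinger V) g⟫_ℂ := by
  obtain ⟨hf, hf'⟩ := form_resolvent hV f
  obtain ⟨hg, hg'⟩ := form_resolvent hV g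
  have h1 := hg' ⟨_, hf⟩
  rw [← form_conj, hf' ⟨_, hg⟩, inner_conj_symm, inner_sub_left, inner_sub_right] at h1
  exact (sub_left_injective h1).symm

lemma resolvent_nonneg (hV : LocallyIntegrable V volume) : 0 ≤ resolvent (schrodinger V) := by
  rw [ContinuousLinearMap.nonneg_iff_isPositive, ContinuousLinearMap.isPositive_def]
  refine ⟨fun f g => isSymmetric_resolvent hV f g, fun f => ?_⟩
  rw [ContinuousLinearMap.reApplyInnerSelf_apply]
  have h1 := inner_resolvent_sub_re_nonneg hV f
  have h2 := inner_self_nonneg (𝕜 := ℂ) (x := resolvent (schrodinger V) f)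
  rw [inner_sub_right, Complex.sub_re] at h1
  simp only [RCLike.re_to_complex] at h2 ⊢
  linarith

lemma resolvent_le_one (hV : LocallyIntegrable V volume) : resolvent (schrodinger V) ≤ 1 := by
  rw [ContinuousLinearMap.le_def, ContinuousLinearMap.isPositive_def]
  refine ⟨fun f g => ?_, fun f => ?_⟩
  · have := isSymmetric_resolvent hV f g
    change ⟪f - resolvent (schrodinger V) f, g⟫_ℂ = ⟪f, g - resolvent (schrodinger V) g⟫_ℂ
    rw [inner_sub_left, inner_sub_right, this]
  · rw [ContinuousLinearMap.reApplyInnerSelf_apply]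
    change 0 ≤ (⟪f - resolvent (schrodinger V) f, f⟫_ℂ).re
    set R := resolvent (schrodinger V) with hR
    have h1 : 0 ≤ (⟪f - R f, R f⟫_ℂ).re := by
      have := inner_resolvent_sub_re_nonneg hV f
      rwa [← inner_conj_symm, Complex.conj_re] at this
    have h2 := inner_self_nonneg (𝕜 := ℂ) (x := f - R f)
    rw [inner_sub_right, map_sub] at h2
    simp only [RCLike.re_to_complex] at h2
    linarith

lemma resolvent_injective (hV : LocallyIntegrable V volume) :
    Function.Injective (resolvent (schrodinger V)) := by
  refine (injective_iff_map_eq_zero _).2 fun f hf => ?_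
  have h := isResolvent_resolvent hV f
  rw [hf, sub_zero] at h
  exact LinearPMap.graph_fst_eq_zero_snd _ h rfl

lemma exists_eq_resolvent (hV : LocallyIntegrable V volume) {u : L2 n}
    (hu : u ∈ (schrodinger V).domain) : ∃ f, resolvent (schrodinger V) f = u := by
  have h := LinearPMap.mem_graph _ (⟨u, hu⟩ : (schrodinger V).domain)
  set w := schrodinger V ⟨u, hu⟩
  -- The witness is (1 + A)u. The difference d of the two candidates satisfies Ad = -d, so
  -- non-negativity of the form forces d = 0.
  refine ⟨u + w, ?_⟩
  have h2 := Submodule.sub_mem _ h (isResolvent_resolvent hV (u + w))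
  rw [schrodinger_graph hV] at h2
  obtain ⟨hd, hd'⟩ := h2
  set d := u - resolvent (schrodinger V) (u + w) with hdef
  have e : form V ⟨d, hd⟩ ⟨d, hd⟩ = ⟪d, -d⟫_ℂ := by
    refine (hd' ⟨d, hd⟩).trans ?_
    congr 1
    change w - (u + w - resolvent (schrodinger V) (u + w)) = -d
    rw [hdef]
    abel
  have h3 := form_self_re_nonneg (⟨d, hd⟩ : H1V V)
  rw [e, inner_neg_right, Complex.neg_re] at h3
  have h4 : ‖d‖ ^ 2 ≤ 0 := by
    rw [← inner_self_eq_norm_sq (𝕜 := ℂ)]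
    simp only [RCLike.re_to_complex]
    linarith
  have h5 : d = 0 := by
    rw [← norm_eq_zero]
    nlinarith [norm_nonneg d]
  exact (sub_eq_zero.1 h5).symm

lemma fracPow_resolvent (hV : LocallyIntegrable V volume) {γ : ℝ} (hγ : γ ∈ Icc (0 : ℝ) 1)
    (f : L2 n) : ∃ h : resolvent (schrodinger V) f ∈ (fracPow (schrodinger V) γ).domain,
      fracPow (schrodinger V) γ ⟨_, h⟩ = powRes (resolvent (schrodinger V)) γ f := by
  have h := powRes_mem_fracPow_graph (resolvent_nonneg hV) (resolvent_le_one hV)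
    (resolvent_injective hV) hγ f
  have hd := LinearPMap.mem_domain_of_mem_graph h
  exact ⟨hd, LinearPMap.mem_graph_snd_inj _ (LinearPMap.mem_graph _ ⟨_, hd⟩) h rfl⟩

/-- The substitution u = R f, a bijection onto D(A), replaces the unbounded power of A by the
bounded `powRes` and removes the quotient. -/
lemma bracket_le_iff (hV : LocallyIntegrable V volume) {α : ℝ} (hα : α / 2 ∈ Icc (0 : ℝ) 1)
    {C : ℝ≥0∞} (hC : C ≠ ∞) : bracket V α ≤ C ↔ ∀ f : L2 n,
      potNorm V (α / 2) (resolvent (schrodinger V) f) +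
        lapNorm (α / 2) (resolvent (schrodinger V) f) ≤
      C * ‖powRes (resolvent (schrodinger V)) (α / 2) f‖ₑ := by
  have key : ∀ x y : ℝ≥0∞, y ≠ ∞ → (x / y ≤ C ↔ x ≤ C * y) := fun x y hy =>
    ENNReal.div_le_iff_le_mul (Or.inr hC) (Or.inl hy)
  rw [bracket]
  constructor
  · intro h f
    obtain ⟨hd, he⟩ := fracPow_resolvent hV hα f
    have hmem : resolvent (schrodinger V) f ∈ (schrodinger V).domain :=
      LinearPMap.mem_domain_of_mem_graph (isResolvent_resolvent hV f)
    have := (iSup₂_le_iff.1 h) ⟨_, hd⟩ hmem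
    rwa [he, key _ _ enorm_ne_top] at this
  · intro h
    refine iSup₂_le ?_
    rintro ⟨u, hu⟩ hmem
    obtain ⟨f, rfl⟩ := exists_eq_resolvent hV hmem
    obtain ⟨hd, he⟩ := fracPow_resolvent hV hα f
    rw [key _ _ enorm_ne_top, he]
    exact h f

lemma le_ofReal_of_sq_le {a : ℝ≥0∞} {c d : ℝ} (hd : 0 ≤ d) (hc : c ≤ d ^ 2)
    (ha : a ^ 2 ≤ ENNReal.ofReal c) : a ≤ ENNReal.ofReal d := by
  have h1 := ha.trans (ENNReal.ofReal_le_ofReal hc)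
  rw [ENNReal.ofReal_pow hd] at h1
  exact (ENNReal.pow_le_pow_left_iff two_ne_zero).1 h1

lemma potNorm_half_eq (u : H1V V) : potNorm V (1 / 2) (u : L2 n) = ‖sqrtMul V u‖ₑ := by
  rw [Lp.enorm_def, eLpNorm_congr_ae (coeFn_sqrtMul u)]
  rfl

lemma norm_powRes_half_sq_eq_form (hV : LocallyIntegrable V volume) (f : L2 n) :
    ∃ u : H1V V, (u : L2 n) = resolvent (schrodinger V) f ∧
      ‖powRes (resolvent (schrodinger V)) (1 / 2) f‖ ^ 2 =
        ∑ i, ‖partialD V i u‖ ^ 2 + ‖sqrtMul V u‖ ^ 2 := by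
  obtain ⟨h, hf⟩ := form_resolvent hV f
  refine ⟨⟨_, h⟩, rfl, ?_⟩
  have h2 := hf ⟨_, h⟩
  rw [form_self] at h2
  rw [norm_powRes_half_sq (resolvent_nonneg hV) (resolvent_le_one hV) f, ← h2, Complex.ofReal_re]

lemma half_power_bounds (hV : LocallyIntegrable V volume) (f : L2 n) :
    potNorm V (1 / 2) (resolvent (schrodinger V) f) ≤
        ENNReal.ofReal ‖powRes (resolvent (schrodinger V)) (1 / 2) f‖ ∧
      lapNorm (1 / 2) (resolvent (schrodinger V) f) ≤
        ENNReal.ofReal ‖powRes (resolvent (schrodinger V)) (1 / 2) f‖ := by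
  obtain ⟨u, hu, e⟩ := norm_powRes_half_sq_eq_form hV f
  rw [← hu]
  constructor
  · refine le_ofReal_of_sq_le (c := ‖sqrtMul V u‖ ^ 2) (norm_nonneg _) ?_ (le_of_eq ?_)
    · rw [e]
      exact le_add_of_nonneg_left (Finset.sum_nonneg fun i _ => sq_nonneg _)
    · rw [ENNReal.ofReal_pow (norm_nonneg _), ofReal_norm, potNorm_half_eq]
  · refine le_ofReal_of_sq_le (c := ∑ i, ‖partialD V i u‖ ^ 2) (norm_nonneg _) ?_
      (lapNorm_half_sq_le fun i => partialD_mem_graph V i u)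
    rw [e]
    exact le_add_of_nonneg_right (sq_nonneg _)

/-- The strict upper bound M is automatically positive, as the interpolation requires of its
constants; the bracket itself is not known to be. -/
lemma bracket_le_of_lt (hV : LocallyIntegrable V volume) {α β : ℝ} (hα : α ∈ Ioc (1 : ℝ) 2)
    (hβ : β ∈ Icc 1 α) {M : ℝ≥0∞} (hM : bracket V α < M) (hMtop : M ≠ ∞) :
    bracket V β ≤ 2 * M ^ ((β - 1) / (α - 1)) := by
  have hα1 : 0 < α - 1 := by linarith [hα.1]
  set θ := (β - 1) / (α - 1) with hθdef
  have hθ : θ ∈ Icc (0 : ℝ) 1 :=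
    ⟨div_nonneg (by linarith [hβ.1]) hα1.le, div_le_one_of_le₀ (by linarith [hβ.2]) hα1.le⟩
  have hγ : (1 - θ) * (1 / 2) + θ * (α / 2) = β / 2 := by
    rw [hθdef]
    field_simp
    ring
  have hM0 : 0 < M := pos_of_gt hM
  have hMr : 0 < M.toReal := ENNReal.toReal_pos hM0.ne' hMtop
  have hMθ : M ^ θ = ENNReal.ofReal (M.toReal ^ θ) := by
    rw [← ENNReal.ofReal_rpow_of_pos hMr, ENNReal.ofReal_toReal hMtop]
  have hα2 : α / 2 ∈ Icc (0 : ℝ) 1 := ⟨by linarith, by linarith [hα.2]⟩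
  have hβ2 : β / 2 ∈ Icc (0 : ℝ) 1 := ⟨by linarith [hβ.1], by linarith [hβ.2, hα.2]⟩
  set R := resolvent (schrodinger V) with hR
  have hbound : ∀ f, potNorm V (α / 2) (R f) + lapNorm (α / 2) (R f) ≤
      ENNReal.ofReal (M.toReal * ‖powRes R (α / 2) f‖) := by
    intro f
    rw [ENNReal.ofReal_mul hMr.le, ENNReal.ofReal_toReal hMtop, ofReal_norm]
    exact (bracket_le_iff hV hα2 hMtop).1 hM.le f
  rw [bracket_le_iff hV hβ2 (ENNReal.mul_ne_top (by norm_num)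
    (ENNReal.rpow_ne_top_of_nonneg hθ.1 hMtop))]
  intro f
  -- In this form (-Δ)^s is the s-th power of the single multiplier m(ξ) = (2π|ξ|)².
  have hlap : ∀ s (u : L2 n), lapNorm s u = eLpNorm (fun ξ : Rn n =>
      ((((2 * Real.pi * ‖ξ‖) ^ 2) ^ s : ℝ) : ℂ) * (𝓕 u : L2 n) ξ) 2 volume := by
    intro s u
    rw [lapNorm]
    congr 1
    ext ξ
    rw [← Real.rpow_natCast, ← Real.rpow_mul (by positivity)]
    norm_num
  have b1 := eLpNorm_rpow_mul_le_interpolate (resolvent_nonneg hV) (resolvent_le_one hV)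
    (resolvent_injective hV) (ContinuousLinearMap.id ℂ (L2 n)) (m := fun x => ‖V x‖)
    hV.aestronglyMeasurable.norm.aemeasurable (fun x => norm_nonneg _)
    (a := 1 / 2) (b := α / 2) (M₀ := 1) (M₁ := M.toReal) (by norm_num) (by linarith) hα2.2
    one_pos hMr (fun f => by rw [one_mul]; exact (half_power_bounds hV f).1)
    (fun f => le_self_add.trans (hbound f)) hθ f
  have b2 := eLpNorm_rpow_mul_le_interpolate (resolvent_nonneg hV) (resolvent_le_one hV)
    (resolvent_injective hV)
    ((Lp.fourierTransformₗᵢ (Rn n) ℂ).toContinuousLinearEquiv : L2 n →L[ℂ] L2 n)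
    (m := fun ξ : Rn n => (2 * Real.pi * ‖ξ‖) ^ 2)
    (by fun_prop) (fun x => by positivity)
    (a := 1 / 2) (b := α / 2) (M₀ := 1) (M₁ := M.toReal) (by norm_num) (by linarith) hα2.2
    one_pos hMr
    (fun f => by rw [one_mul]; exact (hlap _ _).symm.le.trans (half_power_bounds hV f).2)
    (fun f => (hlap _ _).symm.le.trans (le_add_self.trans (hbound f))) hθ f
  rw [hγ, Real.one_rpow, one_mul, ENNReal.ofReal_mul (by positivity), ofReal_norm, ← hMθ] at b1 b2
  rw [two_mul, add_mul, hlap]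
  exact add_le_add b1 b2

/-- Let M decrease to the bracket, by continuity of powers on [0, ∞]. -/
lemma bracket_le_two_mul_rpow (hV : LocallyIntegrable V volume) {α β : ℝ}
    (hα : α ∈ Ioc (1 : ℝ) 2) (hβ : β ∈ Icc 1 α) (h : bracket V α < ∞) :
    bracket V β ≤ 2 * bracket V α ^ ((β - 1) / (α - 1)) := by
  have hlim : Filter.Tendsto (fun M : ℝ≥0∞ => 2 * M ^ ((β - 1) / (α - 1)))
      (nhdsWithin (bracket V α) (Ioi (bracket V α)))
      (nhds (2 * bracket V α ^ ((β - 1) / (α - 1)))) := by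
    refine ENNReal.Tendsto.const_mul ?_ (Or.inr (by norm_num))
    exact (ENNReal.continuous_rpow_const.tendsto _).mono_left nhdsWithin_le_nhds
  have : (nhdsWithin (bracket V α) (Ioi (bracket V α))).NeBot :=
    nhdsGT_neBot_of_exists_gt ⟨∞, h⟩
  refine ge_of_tendsto hlim ?_
  filter_upwards [Ioo_mem_nhdsGT h] with M hM
  exact bracket_le_of_lt hV hα hβ hM.1 hM.2.ne

end Resolvent

end KatoPotential

end

theorem proposition5p3 (n : ℕ) (hn : 1 ≤ n) :
    (∀ α ∈ Set.Ioc (1 : ℝ) 2, ∀ V ∈ KatoPotential.W n α, ∀ β ∈ Set.Icc (1 : ℝ) α,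
      V ∈ KatoPotential.W n β ∧
        KatoPotential.bracket V β ≤ 2 * KatoPotential.bracket V α ^ ((β - 1) / (α - 1))) ∧
    (∀ α ∈ Set.Icc (1 : ℝ) 2, ∀ β ∈ Set.Icc (1 : ℝ) 2, β ≤ α →
      KatoPotential.W n α ⊆ KatoPotential.W n β) := by
  have key : ∀ α ∈ Set.Ioc (1 : ℝ) 2, ∀ V ∈ KatoPotential.W n α, ∀ β ∈ Set.Icc (1 : ℝ) α,
      V ∈ KatoPotential.W n β ∧
        KatoPotential.bracket V β ≤ 2 * KatoPotential.bracket V α ^ ((β - 1) / (α - 1)) := by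
    rintro α hα V ⟨hV, hV'⟩ β hβ
    have h := KatoPotential.bracket_le_two_mul_rpow hV hα hβ hV'
    refine ⟨⟨hV, h.trans_lt ?_⟩, h⟩
    exact ENNReal.mul_lt_top (by norm_num) (ENNReal.rpow_lt_top_of_nonneg
      (div_nonneg (by linarith [hβ.1]) (by linarith [hα.1])) hV'.ne)
  refine ⟨key, fun α hα β hβ hβα => ?_⟩
  -- At α = 1 the exponent (β-1)/(α-1) is not meaningful, but then β = α and the inclusion is
  -- trivial.
  rcases hα.1.eq_or_lt with h | h
  · have : α = β := le_antisymm (h ▸ hβ.1) hβα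
    rw [this]
  · exact fun V hV => (key α ⟨h, hα.2⟩ V hV β ⟨hβ.1, hβα⟩).1
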